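/- **Setting.** Let $L$ be a first-order signature, let $\mathbf K$ be a class of $L$-structures and $\preccurlyeq$ a binary relation on $\mathbf K$. Write $A\le B$ if $A$ is a substructure of $B$. The pair $(\mathbf K,\preccurlyeq)$ is an *abstract class* if $\mathbf K$ and $\preccurlyeq$ are closed under isomorphisms, $A\preccurlyeq B$ implies $A\le B$, and $\preccurlyeq$ is a partial order on $\mathbf K$. It is a *weak AEC* with Löwenheim–Skolem number $\mu$, where $\mu\ge|L|+\aleph_0$, if moreover: * for every limit ordinal $\delta$ and every increasing continuous $\preccurlyeq$-chain $(A_i)_{i<\delta}$ in $\mathbf K$ one has $\bigcup_{i<\delta}A_i\in\mathbf K$ and $A_j\preccurlyeq\bigcup_{i<\delta}A_i$ for all $j<\delta$; * for all $A\in\mathbf K$ and $X\subseteq A$ there is $C\in\mathbf K$ with $X\subseteq C\preccurlyeq A$ and $|C|\le|X|+\mu$. An embedding $f:A\to B$ with $A,B\in\mathbf K$ is *strong* if $f(A)\preccurlyeq B$. For $A,B\in\mathbf K$, $B$ is *universal over* $A$ if for every $C\in\mathbf K$ with $A\preccurlyeq C$ and $|C|=|A|$ there is a strong embedding $f:C\to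 B$ with $f\restriction A=\mathrm{id}_A$. Write $\mathbf K_\kappa$ for the structures in $\mathbf K$ of size $\kappa$. For $\kappa\ge\mu+\aleph_0$, the weak AEC is *strongly $\kappa^+$-categorical* if: * $\mathbf K$ has, up to isomorphism, exactly one structure of size $\kappa^+$, denoted $F(\kappa^+)$; * every $A\in\mathbf K_\kappa$ has some $B\in\mathbf K_\kappa$ with $A\preccurlyeq B$ and $A\ne B$; * every $A\in\mathbf K_\kappa$ has some $B\in\mathbf K_\kappa$ which is universal over $A$. For a limit ordinal $\delta<\kappa^+$ and $A\preccurlyeq B$ in $\mathbf K$, $B$ is a *$(\kappa,\delta)$-limit over* $A$ if there is an increasing continuous $\preccurlyeq$-chain $(B_i)_{i<\delta}$ of structures in $\mathbf K_\kappa$ with $B_0=A$, $B=\bigcup_{i<\delta}B_i$, and $B_{i+1}$ universal over $B_i$ for all $i<\delta$. Finally, $A\equiv_{\infty,\kappa^+}B$ means that $A$ and $B$ satisfy the same sentences of $\mathfrak L_{\infty,\kappa^+}$, the logic obtained from the atomic $L$-formulas by negation, conjunctions and disjunctions of arbitrary sets of formulas, and quantification over sets of at most $\kappa$ variables, where every formula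 has at most $\kappa$ free variables. **Theorem.** Let $(\mathbf K,\preccurlyeq)$ be a weak AEC with Löwenheim–Skolem number $\mu$, let $\kappa\ge\mu+\aleph_0$, and suppose that $(\mathbf K,\preccurlyeq)$ is strongly $\kappa^+$-categorical. Let $A$ be any $L$-structure (not necessarily in $\mathbf K$). Then the following are equivalent: 1. $A\equiv_{\infty,\kappa^+}F(\kappa^+)$; 2. for every limit ordinal $\delta<\kappa^+$ there is a nonempty set $\mathcal S_\delta$ of substructures of $A$ belonging to $\mathbf K_\kappa$ such that for every $B\in\mathcal S_\delta$ and every $C\subseteq A$ with $|C|\le\kappa$ there is $B'\in\mathcal S_\delta$ such that $B\cup C\subseteq B'$ and $B'$ is a $(\kappa,\delta)$-limit over $B$; 3. for some limit ordinal $\delta<\kappa^+$ there is a nonempty set $\mathcal S$ of substructures of $A$ belonging to $\mathbf K_\kappa$ such that for every $B\in\mathcal S$ and every $C\subseteq A$ with $|C|\le\kappa$ there is $B'\in\mathcal S$ such that $B\cup C\subseteq B'$ and $B'$ is a $(\kappa,\delta)$-limit over $B$. -/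

import Mathlib

open FirstOrder Cardinal

universe u

namespace KuekerAEC

/-! ### The infinitary logic `L_{∞,lam}` -/

/-- Formulas of `L_{∞,lam}` with free variables indexed by `α`: built from atomic formulas by
negation, conjunctions of arbitrary (set-sized) families of formulas, and existential
quantification over a block of fewer than `lam` variables. Disjunctions and universal quantifiers
are obtained by negation. A quantifier adds the block `β` of its bound variables to the free
variables of its scope, so (for infinite `lam`) all subformulas of a sentence have fewer than
`lam` free variables. -/
inductive InfFormula (L : FirstOrder.Language.{u, u}) (lam : Cardinal.{u}) : Type u → Type (u + 1)
  | equal {α : Type u} (t s : L.Term α) : InfFormula L lam α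
  | rel {α : Type u} {n : ℕ} (R : L.Relations n) (ts : Fin n → L.Term α) : InfFormula L lam α
  | neg {α : Type u} (φ : InfFormula L lam α) : InfFormula L lam α
  | conj {α : Type u} (ι : Type u) (φ : ι → InfFormula L lam α) : InfFormula L lam α
  | ex {α : Type u} (β : Type u) (hβ : #β < lam) (φ : InfFormula L lam (α ⊕ β)) :
      InfFormula L lam α

/-- Satisfaction of a formula of `L_{∞,lam}` in `M` under an assignment `v`. -/
def InfFormula.Realize {L : FirstOrder.Language.{u, u}} {lam : Cardinal.{u}} (M : Type u) [L.Structure M] :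
    {α : Type u} → InfFormula L lam α → (α → M) → Prop
  | _, .equal t s, v => t.realize v = s.realize v
  | _, .rel R ts, v => FirstOrder.Language.Structure.RelMap R (fun i => (ts i).realize v)
  | _, .neg φ, v => ¬ φ.Realize M v
  | _, .conj _ φ, v => ∀ i, (φ i).Realize M v
  | _, .ex β _ φ, v => ∃ w : β → M, φ.Realize M (Sum.elim v w)

/-- `M ≡_{∞,lam} N`: the same sentences of `L_{∞,lam}` are true in `M` and in `N`. -/
def InfEquiv (L : FirstOrder.Language.{u, u}) (lam : Cardinal.{u}) (M N : Type u) [L.Structure M]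
    [L.Structure N] : Prop :=
  ∀ φ : InfFormula L lam PEmpty.{u + 1}, φ.Realize M PEmpty.elim ↔ φ.Realize N PEmpty.elim

/-! ### Abstract classes and weak AECs -/

/-- A class of `L`-structures together with a binary relation between structures and their
substructures; `K.Strong N` means `N ≼ M`, for `N` a substructure of `M`. That `N ≼ M` implies
`N ≤ M` is thus built in, and antisymmetry of `≼` follows from that of `≤`. -/
structure StructureClass (L : FirstOrder.Language.{u, u}) where
  Mem : (M : Type u) → [L.Structure M] → Prop
  Strong : {M : Type u} → [L.Structure M] → L.Substructure M → Prop

namespace StructureClass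

variable {L : FirstOrder.Language.{u, u}} (K : StructureClass L)

/-- `A ≼ B` for two substructures of a common structure `M` (not assumed to be in `K`). -/
def StrongLE {M : Type u} [L.Structure M] (A B : L.Substructure M) : Prop :=
  A ≤ B ∧ K.Strong (A.comap B.subtype.toHom)

/-- Abstract classes: `≼` is a relation on `K`; both are closed under isomorphism; `≼` is
reflexive and transitive on `K`. -/
structure IsAbstractClass : Prop where
  mem_of_strong : ∀ (M : Type u) [L.Structure M] (N : L.Substructure M),
    K.Strong N → K.Mem M ∧ K.Mem N
  mem_iso : ∀ (M M' : Type u) [L.Structure M] [L.Structure M'], (M ≃[L] M') →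
    K.Mem M → K.Mem M'
  strong_iso : ∀ (M M' : Type u) [L.Structure M] [L.Structure M'] (e : M ≃[L] M')
    (N : L.Substructure M), K.Strong N → K.Strong (N.map e.toHom)
  refl : ∀ (M : Type u) [L.Structure M], K.Mem M → K.Strong (⊤ : L.Substructure M)
  trans : ∀ (M : Type u) [L.Structure M] (P N : L.Substructure M),
    K.StrongLE P N → K.Strong N → K.Strong P

/-- `(A i)`, `i < δ`, is an increasing continuous `≼`-chain of structures in `K`; the chain is
given inside a common structure `M`, for instance its union. -/
structure IsContChain {M : Type u} [L.Structure M] (δ : Ordinal.{u})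
    (A : Ordinal.{u} → L.Substructure M) : Prop where
  mem : ∀ i < δ, K.Mem (A i)
  strong : ∀ i j, i ≤ j → j < δ → K.StrongLE (A i) (A j)
  cont : ∀ i < δ, Order.IsSuccLimit i → A i = ⨆ j < i, A j

/-- `μ` is a Löwenheim-Skolem number of `K`. -/
def IsLSNumber (μ : Cardinal.{u}) : Prop :=
  L.card + ℵ₀ ≤ μ ∧ ∀ (M : Type u) [L.Structure M], K.Mem M → ∀ X : Set M,
    ∃ N : L.Substructure M, X ⊆ (N : Set M) ∧ K.Strong N ∧ #N ≤ #X + μ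

/-- Weak AECs with Löwenheim-Skolem number `μ`: neither smoothness nor coherence is required. -/
structure IsWeakAEC (μ : Cardinal.{u}) : Prop extends K.IsAbstractClass where
  union_mem : ∀ (M : Type u) [L.Structure M] (δ : Ordinal.{u})
    (A : Ordinal.{u} → L.Substructure M), Order.IsSuccLimit δ → K.IsContChain δ A →
      K.Mem (⨆ i < δ, A i : L.Substructure M)
  strong_union : ∀ (M : Type u) [L.Structure M] (δ : Ordinal.{u})
    (A : Ordinal.{u} → L.Substructure M), Order.IsSuccLimit δ → K.IsContChain δ A →
      ∀ j < δ, K.StrongLE (A j) (⨆ i < δ, A i)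
  isLSNumber : K.IsLSNumber μ

/-- `f : M → N` is a strong embedding: `f(M) ≼ N`. -/
def IsStrongEmbedding {M N : Type u} [L.Structure M] [L.Structure N] (f : M ↪[L] N) : Prop :=
  K.Strong f.toHom.range

/-! ### Categoricity, universality, limit models -/

/-- `K` has exactly one model of cardinality `lam`, up to isomorphism. -/
def IsCategorical (lam : Cardinal.{u}) : Prop :=
  (∃ (M : Type u) (_ : L.Structure M), K.Mem M ∧ #M = lam) ∧
    ∀ (M N : Type u) [L.Structure M] [L.Structure N], K.Mem M → #M = lam → K.Mem N → #N = lam →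
      Nonempty (M ≃[L] N)

/-- `B` is `(K, ≼)`-universal over `A`, where `A` is regarded as a substructure of `B` through
the embedding `i`: every `C ∈ K` of the size of `A` with `A ≼ C` (through `g`) has a strong
embedding into `B` which is the identity on `A`. -/
def IsUniversalOver {A B : Type u} [L.Structure A] [L.Structure B] (i : A ↪[L] B) : Prop :=
  K.Mem A ∧ K.Mem B ∧
    ∀ (C : Type u) [L.Structure C] (g : A ↪[L] C), K.IsStrongEmbedding g → #C = #A →
      ∃ f : C ↪[L] B, K.IsStrongEmbedding f ∧ ∀ a, f (g a) = i a

/-- The conditions that make a weak AEC strongly `κ⁺`-categorical. -/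
structure IsStronglyCategorical (κ : Cardinal.{u}) : Prop where
  categorical : K.IsCategorical (Order.succ κ)
  exists_proper_extension : ∀ (A : Type u) [L.Structure A], K.Mem A → #A = κ →
    ∃ (B : Type u) (_ : L.Structure B) (i : A ↪[L] B),
      #B = κ ∧ K.IsStrongEmbedding i ∧ ¬ Function.Surjective i
  exists_universal : ∀ (A : Type u) [L.Structure A], K.Mem A → #A = κ →
    ∃ (B : Type u) (_ : L.Structure B) (i : A ↪[L] B), #B = κ ∧ K.IsUniversalOver i

/-- For substructures `A`, `B` of a structure `M`: `B` is a `(κ, δ)`-`(K, ≼)`-limit model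
over `A`. -/
def IsLimitOver {M : Type u} [L.Structure M] (κ : Cardinal.{u}) (δ : Ordinal.{u})
    (B A : L.Substructure M) : Prop :=
  K.StrongLE A B ∧ ∃ D : Ordinal.{u} → L.Substructure M,
    K.IsContChain δ D ∧ D 0 = A ∧ B = ⨆ i < δ, D i ∧
    (∀ i < δ, ∃ h : D i ≤ D (i + 1), K.IsUniversalOver (FirstOrder.Language.Substructure.inclusion h)) ∧
    ∀ i < δ, #(D i) = κ

/-! ### Free structures -/

/-- `A ≡_{∞,κ⁺} F(κ⁺)`, where `F(κ⁺)` is the model of cardinality `κ⁺` in `K` (which is unique up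
to isomorphism in a `κ⁺`-categorical class). -/
def IsInfFree (κ : Cardinal.{u}) (A : Type u) [L.Structure A] : Prop :=
  ∃ (F : Type u) (_ : L.Structure F), K.Mem F ∧ #F = Order.succ κ ∧
    InfEquiv L (Order.succ κ) A F

/-- `S` is a nonempty set of substructures of `A` from `K_κ` such that for all `B ∈ S` and
`C ⊆ A` of size at most `κ` some `B' ∈ S` contains `B ∪ C` and is a `(κ, δ)`-limit over `B`. -/
def IsLimitClosedFamily {A : Type u} [L.Structure A] (κ : Cardinal.{u}) (δ : Ordinal.{u})
    (S : Set (L.Substructure A)) : Prop :=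
  S.Nonempty ∧ (∀ B ∈ S, K.Mem B ∧ #B = κ) ∧
    ∀ B ∈ S, ∀ C : Set A, #C ≤ κ →
      ∃ B' ∈ S, (B : Set A) ∪ C ⊆ (B' : Set A) ∧ K.IsLimitOver κ δ B' B

/-- `A` is strongly `κ⁺`-free. -/
def IsStronglyFree (κ : Cardinal.{u}) (A : Type u) [L.Structure A] : Prop :=
  ∃ δ : Ordinal.{u}, Order.IsSuccLimit δ ∧ δ < (Order.succ κ).ord ∧
    ∃ S : Set (L.Substructure A), K.IsLimitClosedFamily κ δ S

end StructureClass

end KuekerAEC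

open FirstOrder.Language

namespace KuekerAEC
namespace StructureClass

variable {L : FirstOrder.Language.{u, u}} {K : StructureClass L}

/-! ### Invariance of membership and `≼` under isomorphisms and embeddings -/

section Transfer

variable {M M' : Type u} [L.Structure M] [L.Structure M']

/-! Two facts carry the equivalence. First, limit extensions of the same length are unique: an
isomorphism `A ≅ A'` extends to any `(κ, δ)`-limits over `A` and `A'`
(`IsLimitOver.exists_partialEquiv`). Hence limit-closed families for the same `δ`, one in each of
two structures, give a back-and-forth system between these structures as soon as some member of one
is isomorphic to some member of the other (`IsLimitClosedFamily.infEquiv`).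

Second, `F(κ⁺)` has such families for every `δ`. From any structure in `K_κ` one builds a continuous
chain of length `κ⁺` with universal successor steps. Its union lies in `K` and has size `κ⁺`, so by
categoricity it is `F(κ⁺)` (`IsWeakAEC.exists_isUniversalChain_of_card`). By regularity of `κ⁺`
every set of size at most `κ` lies in a member of the chain, and going `δ` steps further gives a
limit, so the members form a limit-closed family (`IsUniversalChain.isLimitClosedFamily`).

For 1 → 2 such a family is moved from `F(κ⁺)` to `A` along `≡_{∞,κ⁺}`: its copies are the ranges of
tuples of `A` with the same infinitary type as an enumeration of a member
(`IsLimitClosedFamily.exists_of_infEquiv`). For 3 → 1 the chain in `F(κ⁺)` is started at a copy of a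
member of the given family, which provides the first partial isomorphism. -/

theorem IsAbstractClass.mem_congr (hK : K.IsAbstractClass) (e : M ≃[L] M') :
    K.Mem M ↔ K.Mem M' :=
  ⟨hK.mem_iso _ _ e, hK.mem_iso _ _ e.symm⟩

/-- The pointwise hypothesis makes this applicable to substructures that are not written as images.
-/
theorem IsAbstractClass.strong_of_equiv (hK : K.IsAbstractClass) (e : M ≃[L] M')
    {N : L.Substructure M} {N' : L.Substructure M'} (h : ∀ x, x ∈ N ↔ e x ∈ N')
    (hN : K.Strong N) : K.Strong N' := by
  have : N.map e.toHom = N' := by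
    ext y
    simp only [Substructure.mem_map, Equiv.coe_toHom]
    constructor
    · rintro ⟨x, hx, rfl⟩
      exact (h x).1 hx
    · intro hy
      exact ⟨e.symm y, (h _).2 (by simpa using hy), by simp⟩
  exact this ▸ hK.strong_iso _ _ e N hN

theorem IsAbstractClass.strongLE_of_equiv (hK : K.IsAbstractClass)
    {A B : L.Substructure M} {A' B' : L.Substructure M'} (e : B ≃[L] B') (hle : A' ≤ B')
    (h : ∀ x : B, (x : M) ∈ A ↔ (e x : M') ∈ A') (hAB : K.StrongLE A B) : K.StrongLE A' B' :=
  ⟨hle, hK.strong_of_equiv e (N := A.comap B.subtype.toHom) (fun x => h x) hAB.2⟩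

theorem IsAbstractClass.strongLE_refl (hK : K.IsAbstractClass) {A : L.Substructure M}
    (h : K.Mem A) : K.StrongLE A A := by
  refine ⟨le_rfl, ?_⟩
  convert hK.refl A h
  ext x
  simp

theorem IsAbstractClass.strongLE_trans (hK : K.IsAbstractClass) {A B C : L.Substructure M}
    (hAB : K.StrongLE A B) (hBC : K.StrongLE B C) : K.StrongLE A C := by
  refine ⟨hAB.1.trans hBC.1, hK.trans C _ (B.comap C.subtype.toHom) ?_ hBC.2⟩
  -- Transitivity is an axiom about substructures of one structure, here `C`, so `B` is viewed
  -- inside `C`.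
  let e : B ≃[L] (B.comap C.subtype.toHom) :=
    { toFun := fun x => ⟨⟨x, hBC.1 x.2⟩, x.2⟩
      invFun := fun x => ⟨x, x.2⟩
      left_inv := fun _ => rfl
      right_inv := fun _ => rfl
      map_fun' := fun _ _ => rfl
      map_rel' := fun _ _ => Iff.rfl }
  exact hK.strongLE_of_equiv e (Substructure.monotone_comap hAB.1) (fun x => Iff.rfl) hAB

theorem strongLE_top_iff {A : L.Substructure M} (hK : K.IsAbstractClass) :
    K.StrongLE A ⊤ ↔ K.Strong A :=
  ⟨fun h => hK.strong_of_equiv Substructure.topEquiv (fun _ => Iff.rfl) h.2,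
    fun h => ⟨le_top, hK.strong_of_equiv Substructure.topEquiv.symm (fun _ => Iff.rfl) h⟩⟩

theorem IsAbstractClass.strongLE_map_iff (hK : K.IsAbstractClass) (f : M ↪[L] M')
    {A B : L.Substructure M} :
    K.StrongLE (A.map f.toHom) (B.map f.toHom) ↔ K.StrongLE A B := by
  have hle : A.map f.toHom ≤ B.map f.toHom ↔ A ≤ B :=
    Substructure.map_le_map_iff_of_injective f.injective
  have key : ∀ x : B, (x : M) ∈ A ↔ (f.substructureEquivMap B x : M') ∈ A.map f.toHom := by
    intro x
    simp only [Embedding.substructureEquivMap_apply, Substructure.mem_map, Embedding.coe_toHom]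
    exact ⟨fun h => ⟨_, h, rfl⟩, fun ⟨y, hy, hyx⟩ => f.injective hyx ▸ hy⟩
  constructor
  · intro h
    refine hK.strongLE_of_equiv (f.substructureEquivMap B).symm (hle.1 h.1) (fun x => ?_) h
    rw [key]
    simp
  · intro h
    exact hK.strongLE_of_equiv (f.substructureEquivMap B) (hle.2 h.1) key h

theorem IsAbstractClass.mem_map_iff (hK : K.IsAbstractClass) (f : M ↪[L] M')
    {A : L.Substructure M} : K.Mem (A.map f.toHom) ↔ K.Mem A :=
  hK.mem_congr (f.substructureEquivMap A).symm

theorem card_map (f : M ↪[L] M') (A : L.Substructure M) : #(A.map f.toHom) = #A :=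
  Cardinal.mk_congr (f.substructureEquivMap A).symm.toEquiv

end Transfer

/-! ### Strong embeddings and universal extensions -/

section Universal

theorem IsStrongEmbedding.comp (hK : K.IsAbstractClass) {A B C : Type u} [L.Structure A]
    [L.Structure B] [L.Structure C] {g : B ↪[L] C} {f : A ↪[L] B} (hg : K.IsStrongEmbedding g)
    (hf : K.IsStrongEmbedding f) : K.IsStrongEmbedding (g.comp f) := by
  have h1 : K.StrongLE f.toHom.range ⊤ := (strongLE_top_iff hK).2 hf
  rw [← hK.strongLE_map_iff g, ← Hom.range_eq_map] at h1
  have h2 : K.StrongLE g.toHom.range ⊤ := (strongLE_top_iff hK).2 hg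
  have h3 := (strongLE_top_iff hK).1 (hK.strongLE_trans h1 h2)
  rwa [← Hom.range_comp] at h3

theorem isStrongEmbedding_equiv (hK : K.IsAbstractClass) {A B : Type u} [L.Structure A]
    [L.Structure B] (e : A ≃[L] B) (hA : K.Mem A) : K.IsStrongEmbedding e.toEmbedding := by
  have h : e.toEmbedding.toHom.range = ⊤ := e.toHom_range
  rw [IsStrongEmbedding, h]
  exact hK.refl B (hK.mem_iso _ _ e hA)

theorem isStrongEmbedding_inclusion {M : Type u} [L.Structure M] {A B : L.Substructure M}
    (h : K.StrongLE A B) : K.IsStrongEmbedding (Substructure.inclusion h.1) := by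
  have : (Substructure.inclusion h.1).toHom.range = A.comap B.subtype.toHom := by
    ext x
    simp only [Hom.mem_range, Substructure.mem_comap]
    constructor
    · rintro ⟨y, rfl⟩
      exact y.2
    · intro hx
      exact ⟨⟨x, hx⟩, rfl⟩
  rw [IsStrongEmbedding, this]
  exact h.2

theorem strongLE_of_isStrongEmbedding_inclusion {M : Type u} [L.Structure M]
    {A B : L.Substructure M} (hle : A ≤ B)
    (h : K.IsStrongEmbedding (Substructure.inclusion hle)) : K.StrongLE A B := by
  have : (Substructure.inclusion hle).toHom.range = A.comap B.subtype.toHom := by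
    ext x
    simp only [Hom.mem_range, Substructure.mem_comap]
    constructor
    · rintro ⟨y, rfl⟩
      exact y.2
    · intro hx
      exact ⟨⟨x, hx⟩, rfl⟩
  exact ⟨hle, this ▸ h⟩

variable {A B A' B' : Type u} [L.Structure A] [L.Structure B] [L.Structure A'] [L.Structure B']

/-- Testing universality on `A` itself gives a strong embedding that agrees with `i` everywhere. -/
theorem IsUniversalOver.isStrongEmbedding (hK : K.IsAbstractClass) {i : A ↪[L] B}
    (h : K.IsUniversalOver i) : K.IsStrongEmbedding i := by
  obtain ⟨f, hf, hfi⟩ := h.2.2 A (FirstOrder.Language.Equiv.refl L A).toEmbedding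
    (isStrongEmbedding_equiv hK _ h.1) rfl
  have : f = i := by
    ext a
    simpa using hfi a
  exact this ▸ hf

theorem IsUniversalOver.congr (hK : K.IsAbstractClass) {i : A ↪[L] B} {i' : A' ↪[L] B'}
    (eA : A ≃[L] A') (eB : B ≃[L] B') (hi : ∀ a, i' (eA a) = eB (i a))
    (h : K.IsUniversalOver i) : K.IsUniversalOver i' := by
  refine ⟨hK.mem_iso _ _ eA h.1, hK.mem_iso _ _ eB h.2.1, fun C _ g hg hC => ?_⟩
  obtain ⟨f, hf, hfg⟩ := h.2.2 C (g.comp eA.toEmbedding)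
    (hg.comp hK (isStrongEmbedding_equiv hK eA h.1)) (hC.trans (mk_congr eA.toEquiv).symm)
  refine ⟨eB.toEmbedding.comp f, (isStrongEmbedding_equiv hK eB h.2.1).comp hK hf, fun a => ?_⟩
  have h1 := hfg (eA.symm a)
  have h2 := hi (eA.symm a)
  rw [FirstOrder.Language.Equiv.apply_symm_apply] at h2
  rw [Embedding.comp_apply, FirstOrder.Language.Equiv.coe_toEmbedding,
    FirstOrder.Language.Equiv.apply_symm_apply] at h1
  rw [Embedding.comp_apply, h1, h2]
  rfl

/-- By amalgamation, a structure universal over `B` is universal over the strong substructures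
of `B` of the same size. -/
theorem IsUniversalOver.comp_of_isStrongEmbedding (hK : K.IsAbstractClass) {κ : Cardinal.{u}}
    (hcat : K.IsStronglyCategorical κ) {U : Type u} [L.Structure U] {i : A ↪[L] B}
    {j : B ↪[L] U} (hj : K.IsUniversalOver j) (hA : K.Mem A) (hi : K.IsStrongEmbedding i)
    (hAκ : #A = κ) (hBκ : #B = κ) : K.IsUniversalOver (j.comp i) := by
  refine ⟨hA, hj.2.1, fun C _ g hg hC => ?_⟩
  -- A universal extension `V` of `A` amalgamates `C` and `B` over `A`; universality of `U` over `B`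
  -- then brings `V`, and `C` with it, into `U`.
  obtain ⟨V, _, v, hV, hv⟩ := hcat.exists_universal A hA hAκ
  obtain ⟨f₁, hf₁, hf₁'⟩ := hv.2.2 C g hg hC
  obtain ⟨f₂, hf₂, hf₂'⟩ := hv.2.2 B i hi (hBκ.trans hAκ.symm)
  obtain ⟨h, hh, hh'⟩ := hj.2.2 V f₂ hf₂ (hV.trans hBκ.symm)
  refine ⟨h.comp f₁, hh.comp hK hf₁, fun a => ?_⟩
  simp only [Embedding.comp_apply]
  rw [hf₁', ← hf₂', hh']

/-- A proper strong extension of `A` of size `κ` embeds into `B` over `A`, so its new points need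
room outside the image of `A`. -/
theorem IsUniversalOver.not_surjective {κ : Cardinal.{u}}
    (hcat : K.IsStronglyCategorical κ) {i : A ↪[L] B} (h : K.IsUniversalOver i)
    (hAκ : #A = κ) : ¬ Function.Surjective i := by
  intro hs
  obtain ⟨C, _, g, hC, hg, hns⟩ := hcat.exists_proper_extension A h.1 hAκ
  obtain ⟨f, hf, hfg⟩ := h.2.2 C g hg (hC.trans hAκ.symm)
  refine hns fun c => ?_
  obtain ⟨a, ha⟩ := hs (f c)
  exact ⟨a, f.injective (by rw [hfg, ha])⟩

/-- Universality of `B` over `A` for substructures of a common structure. -/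
def UniversalLE (K : StructureClass L) {M : Type u} [L.Structure M] (A B : L.Substructure M) :
    Prop :=
  ∃ h : A ≤ B, K.IsUniversalOver (Substructure.inclusion h)

theorem UniversalLE.strongLE (hK : K.IsAbstractClass) {M : Type u} [L.Structure M]
    {A B : L.Substructure M} (h : K.UniversalLE A B) : K.StrongLE A B :=
  strongLE_of_isStrongEmbedding_inclusion h.1 (h.2.isStrongEmbedding hK)

theorem UniversalLE.exists_notMem {κ : Cardinal.{u}}
    (hcat : K.IsStronglyCategorical κ) {M : Type u} [L.Structure M]
    {A B : L.Substructure M} (h : K.UniversalLE A B) (hA : #A = κ) : ∃ x ∈ B, x ∉ A := by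
  by_contra! hne
  exact h.2.not_surjective hcat hA fun x => ⟨⟨x, hne x x.2⟩, rfl⟩

theorem UniversalLE.of_strongLE_left (hK : K.IsAbstractClass) {κ : Cardinal.{u}}
    (hcat : K.IsStronglyCategorical κ) {M : Type u} [L.Structure M] {A B C : L.Substructure M}
    (hAB : K.StrongLE A B) (hA : K.Mem A) (hBC : K.UniversalLE B C) (hAκ : #A = κ)
    (hBκ : #B = κ) : K.UniversalLE A C :=
  ⟨hAB.1.trans hBC.1, hBC.2.comp_of_isStrongEmbedding hK hcat hA
    (isStrongEmbedding_inclusion hAB) hAκ hBκ⟩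

theorem UniversalLE.of_equiv (hK : K.IsAbstractClass) {M M' : Type u} [L.Structure M]
    [L.Structure M'] {A B : L.Substructure M} {A' B' : L.Substructure M'} (eA : A ≃[L] A')
    (eB : B ≃[L] B') (hle : A' ≤ B')
    (h : ∀ (x : A) (y : B), (x : M) = y → (eA x : M') = eB y)
    (hAB : K.UniversalLE A B) : K.UniversalLE A' B' :=
  ⟨hle, hAB.2.congr hK eA eB fun a => Subtype.ext (h a _ rfl)⟩

theorem universalLE_map_iff (hK : K.IsAbstractClass) {M M' : Type u} [L.Structure M]
    [L.Structure M'] (f : M ↪[L] M') {A B : L.Substructure M} :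
    K.UniversalLE (A.map f.toHom) (B.map f.toHom) ↔ K.UniversalLE A B := by
  have hle : A.map f.toHom ≤ B.map f.toHom ↔ A ≤ B :=
    Substructure.map_le_map_iff_of_injective f.injective
  constructor
  · intro h
    refine h.of_equiv hK (f.substructureEquivMap A).symm (f.substructureEquivMap B).symm
      (hle.1 h.1) fun x y hxy => f.injective ?_
    rw [← Embedding.substructureEquivMap_apply, ← Embedding.substructureEquivMap_apply]
    simpa using hxy
  · intro h
    refine h.of_equiv hK (f.substructureEquivMap A) (f.substructureEquivMap B)
      (hle.2 h.1) fun x y hxy => ?_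
    simp [hxy]

end Universal

/-! ### Universal chains and limits under embeddings -/

section Chain

variable {M M' : Type u} [L.Structure M] [L.Structure M']

/-- A continuous chain of length `δ` of structures in `K_κ` with universal successor steps. -/
structure IsUniversalChain (K : StructureClass L) (κ : Cardinal.{u}) (δ : Ordinal.{u})
    (D : Ordinal.{u} → L.Substructure M) : Prop where
  cont : K.IsContChain δ D
  universal : ∀ i < δ, K.UniversalLE (D i) (D (i + 1))
  card : ∀ i < δ, #(D i) = κ

theorem isContChain_map_iff (hK : K.IsAbstractClass) (f : M ↪[L] M') {δ : Ordinal.{u}}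
    {D : Ordinal.{u} → L.Substructure M} :
    K.IsContChain δ (fun i => (D i).map f.toHom) ↔ K.IsContChain δ D := by
  have hinj := Substructure.map_injective_of_injective (f := f.toHom) f.injective
  constructor
  · intro h
    refine ⟨fun i hi => (hK.mem_map_iff f).1 (h.mem i hi), fun i j hij hj =>
      (hK.strongLE_map_iff f).1 (h.strong i j hij hj), fun i hi hl => hinj ?_⟩
    rw [h.cont i hi hl]
    simp only [Substructure.map_iSup]
  · intro h
    refine ⟨fun i hi => (hK.mem_map_iff f).2 (h.mem i hi), fun i j hij hj =>
      (hK.strongLE_map_iff f).2 (h.strong i j hij hj), fun i hi hl => ?_⟩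
    rw [h.cont i hi hl]
    simp only [Substructure.map_iSup]

theorem isUniversalChain_map_iff (hK : K.IsAbstractClass) (f : M ↪[L] M') {κ : Cardinal.{u}}
    {δ : Ordinal.{u}} {D : Ordinal.{u} → L.Substructure M} :
    K.IsUniversalChain κ δ (fun i => (D i).map f.toHom) ↔ K.IsUniversalChain κ δ D := by
  constructor
  · intro h
    exact ⟨(isContChain_map_iff hK f).1 h.cont,
      fun i hi => (universalLE_map_iff hK f).1 (h.universal i hi),
      fun i hi => (card_map f _).symm.trans (h.card i hi)⟩
  · intro h
    exact ⟨(isContChain_map_iff hK f).2 h.cont,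
      fun i hi => (universalLE_map_iff hK f).2 (h.universal i hi),
      fun i hi => (card_map f _).trans (h.card i hi)⟩

theorem IsContChain.congr {δ : Ordinal.{u}} {D D' : Ordinal.{u} → L.Substructure M}
    (h : K.IsContChain δ D) (hD : ∀ i < δ, D i = D' i) : K.IsContChain δ D' := by
  refine ⟨fun i hi => hD i hi ▸ h.mem i hi, fun i j hij hj => ?_, fun i hi hl => ?_⟩
  · rw [← hD i (hij.trans_lt hj), ← hD j hj]
    exact h.strong i j hij hj
  · rw [← hD i hi, h.cont i hi hl]
    refine biSup_congr fun j hj => hD j (hj.trans hi)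

theorem IsUniversalChain.congr {κ : Cardinal.{u}} {δ : Ordinal.{u}} (hδ : Order.IsSuccLimit δ)
    {D D' : Ordinal.{u} → L.Substructure M}
    (h : K.IsUniversalChain κ δ D) (hD : ∀ i < δ, D i = D' i) : K.IsUniversalChain κ δ D' := by
  refine ⟨h.cont.congr hD, fun i hi => ?_, fun i hi => hD i hi ▸ h.card i hi⟩
  rw [← hD i hi, ← hD (i + 1) (hδ.add_one_lt hi)]
  exact h.universal i hi

theorem isLimitOver_iff {κ : Cardinal.{u}} {δ : Ordinal.{u}} {A B : L.Substructure M} :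
    K.IsLimitOver κ δ B A ↔ K.StrongLE A B ∧ ∃ D : Ordinal.{u} → L.Substructure M,
      K.IsUniversalChain κ δ D ∧ D 0 = A ∧ B = ⨆ i < δ, D i :=
  ⟨fun ⟨h, D, h1, h2, h3, h4, h5⟩ => ⟨h, D, ⟨h1, h4, h5⟩, h2, h3⟩,
    fun ⟨h, D, h1, h2, h3⟩ => ⟨h, D, h1.1, h2, h3, h1.2, h1.3⟩⟩

theorem map_comap_of_le_range (f : M ↪[L] M') {N : L.Substructure M'}
    (h : N ≤ f.toHom.range) : (N.comap f.toHom).map f.toHom = N := by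
  refine le_antisymm Substructure.map_comap_le fun y hy => ?_
  obtain ⟨x, rfl⟩ := h hy
  exact ⟨x, hy, rfl⟩

theorem isLimitOver_map_iff (hK : K.IsAbstractClass) (f : M ↪[L] M') {κ : Cardinal.{u}}
    {δ : Ordinal.{u}} (hδ : Order.IsSuccLimit δ) {A B : L.Substructure M} :
    K.IsLimitOver κ δ (B.map f.toHom) (A.map f.toHom) ↔ K.IsLimitOver κ δ B A := by
  have hinj := Substructure.map_injective_of_injective (f := f.toHom) f.injective
  rw [isLimitOver_iff, isLimitOver_iff, hK.strongLE_map_iff]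
  refine and_congr_right fun _ => ⟨?_, ?_⟩
  · rintro ⟨D, hD, h0, hB⟩
    -- A witnessing chain in `M'` stays inside its union, hence in the range of `f`, and can be
    -- pulled back. Beyond `δ` its values are unconstrained, so it agrees with the image of the
    -- pullback only below `δ`.
    have hr : ∀ i < δ, ((D i).comap f.toHom).map f.toHom = D i := fun i hi =>
      map_comap_of_le_range f ((le_iSup₂ (f := fun i (_ : i < δ) => D i) i hi).trans
        (hB.symm.le.trans Hom.map_le_range))
    refine ⟨fun i => (D i).comap f.toHom, ?_, ?_, hinj ?_⟩
    · rw [← isUniversalChain_map_iff hK f]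
      exact hD.congr hδ fun i hi => (hr i hi).symm
    · beta_reduce
      rw [h0, Substructure.comap_map_eq_of_injective f.injective]
    · rw [hB]
      simp only [Substructure.map_iSup]
      refine biSup_congr fun i hi => (hr i hi).symm
  · rintro ⟨D, hD, h0, hB⟩
    refine ⟨fun i => (D i).map f.toHom, (isUniversalChain_map_iff hK f).2 hD, ?_, ?_⟩
    · beta_reduce
      rw [h0]
    · rw [hB]
      simp only [Substructure.map_iSup]

end Chain

end StructureClass
end KuekerAEC

namespace KuekerAEC

/-! ### Back-and-forth and types in infinitary logic -/

section Logic

variable {L : FirstOrder.Language.{u, u}} {lam : Cardinal.{u}} {M N : Type u} [L.Structure M]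
  [L.Structure N]

theorem toEquiv_of_le {p q : M ≃ₚ[L] N} (h : p ≤ q) (x : p.dom) :
    (q.toEquiv ⟨x, PartialEquiv.dom_le_dom h x.2⟩ : N) = p.toEquiv x :=
  congrArg Subtype.val (PartialEquiv.toEquiv_inclusion_apply h x)

/-- A back-and-forth system of partial isomorphisms preserves all infinitary formulas. -/
theorem InfFormula.realize_iff_of_backAndForth {S : Set (M ≃ₚ[L] N)}
    (hforth : ∀ p ∈ S, ∀ C : Set M, #C < lam → ∃ q ∈ S, p ≤ q ∧ C ⊆ (q.dom : Set M))
    (hback : ∀ p ∈ S, ∀ C : Set N, #C < lam → ∃ q ∈ S, p ≤ q ∧ C ⊆ (q.cod : Set N))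
    {α : Type u} (φ : InfFormula L lam α) :
    ∀ p ∈ S, ∀ v : α → p.dom,
      φ.Realize M (fun a => (v a : M)) ↔ φ.Realize N (fun a => (p.toEquiv (v a) : N)) := by
  have hterm : ∀ {α : Type u} (p : M ≃ₚ[L] N) (v : α → p.dom) (t : L.Term α),
      t.realize (fun a => (v a : M)) = (t.realize v : p.dom) ∧
      t.realize (fun a => (p.toEquiv (v a) : N)) = p.toEquiv (t.realize v) := by
    intro α p v t
    have h1 := HomClass.realize_term p.dom.subtype (t := t) (v := v)
    have h2 := HomClass.realize_term (p.cod.subtype.comp p.toEquiv.toEmbedding) (t := t) (v := v)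
    exact ⟨h1, h2⟩
  induction φ with
  | equal t s =>
    intro p _ v
    simp only [InfFormula.Realize]
    rw [(hterm p v t).1, (hterm p v s).1, (hterm p v t).2, (hterm p v s).2]
    rw [Subtype.coe_inj, Subtype.coe_inj, p.toEquiv.injective.eq_iff]
  | rel R ts =>
    intro p _ v
    simp only [InfFormula.Realize]
    rw [funext fun i => (hterm p v (ts i)).1, funext fun i => (hterm p v (ts i)).2]
    exact (p.dom.subtype.map_rel R _).trans
      ((p.cod.subtype.comp p.toEquiv.toEmbedding).map_rel R _).symm
  | neg φ ih =>
    intro p hp v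
    exact not_congr (ih p hp v)
  | conj ι φ ih =>
    intro p hp v
    exact forall_congr' fun i => ih i p hp v
  | ex β hβ φ ih =>
    intro p hp v
    simp only [InfFormula.Realize]
    constructor
    · rintro ⟨w, hw⟩
      obtain ⟨q, hq, hpq, hC⟩ := hforth p hp (Set.range w) (mk_range_le.trans_lt hβ)
      have := (ih q hq (Sum.elim (fun a => ⟨v a, PartialEquiv.dom_le_dom hpq (v a).2⟩)
        (fun b => ⟨w b, hC ⟨b, rfl⟩⟩))).1 (by
          convert hw using 1
          ext (a | b) <;> rfl)
      refine ⟨fun b => q.toEquiv ⟨w b, hC ⟨b, rfl⟩⟩, ?_⟩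
      convert this using 1
      ext (a | b)
      · exact (toEquiv_of_le hpq (v a)).symm
      · rfl
    · rintro ⟨w, hw⟩
      obtain ⟨q, hq, hpq, hC⟩ := hback p hp (Set.range w) (mk_range_le.trans_lt hβ)
      have := (ih q hq (Sum.elim (fun a => ⟨v a, PartialEquiv.dom_le_dom hpq (v a).2⟩)
        (fun b => q.toEquiv.symm ⟨w b, hC ⟨b, rfl⟩⟩))).2 (by
          convert hw using 1
          ext (a | b)
          · exact toEquiv_of_le hpq (v a)
          · simp)
      refine ⟨fun b => q.toEquiv.symm ⟨w b, hC ⟨b, rfl⟩⟩, ?_⟩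
      convert this using 1
      ext (a | b) <;> rfl

theorem infEquiv_of_backAndForth {S : Set (M ≃ₚ[L] N)} (hS : S.Nonempty)
    (hforth : ∀ p ∈ S, ∀ C : Set M, #C < lam → ∃ q ∈ S, p ≤ q ∧ C ⊆ (q.dom : Set M))
    (hback : ∀ p ∈ S, ∀ C : Set N, #C < lam → ∃ q ∈ S, p ≤ q ∧ C ⊆ (q.cod : Set N)) :
    InfEquiv L lam M N := by
  intro φ
  obtain ⟨p, hp⟩ := hS
  have := φ.realize_iff_of_backAndForth hforth hback p hp PEmpty.elim
  convert this using 2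
  · ext a; exact a.elim
  · ext a; exact a.elim

/-- `(M, v) ≡_{∞,lam} (N, w)` for tuples `v`, `w` indexed by an arbitrary type. -/
def TupleEquiv (L : FirstOrder.Language.{u, u}) (lam : Cardinal.{u}) {M N : Type u}
    [L.Structure M] [L.Structure N] {α : Type u} (v : α → M) (w : α → N) : Prop :=
  ∀ φ : InfFormula L lam α, φ.Realize M v ↔ φ.Realize N w

theorem TupleEquiv.symm {α : Type u} {v : α → M} {w : α → N} (h : TupleEquiv L lam v w) :
    TupleEquiv L lam w v :=
  fun φ => (h φ).symm

/-- If every `y` failed, some formula true of `x` would be false of `y`. The conjunction of these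
formulas over all `y : β → N` is a single formula; quantifying out the block `β` separates `v` from
`w`. -/
theorem TupleEquiv.exists_sumElim {α β : Type u} {v : α → M} {w : α → N}
    (h : TupleEquiv L lam v w) (hβ : #β < lam) (x : β → M) :
    ∃ y : β → N, TupleEquiv L lam (Sum.elim v x) (Sum.elim w y) := by
  by_contra! hne
  have hφ : ∀ y : β → N, ∃ φ : InfFormula L lam (α ⊕ β),
      φ.Realize M (Sum.elim v x) ∧ ¬ φ.Realize N (Sum.elim w y) := by
    intro y
    obtain ⟨φ, hφ⟩ := not_forall.1 (hne y)
    by_cases hx : φ.Realize M (Sum.elim v x)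
    · exact ⟨φ, hx, fun hy => hφ ⟨fun _ => hy, fun _ => hx⟩⟩
    · refine ⟨.neg φ, hx, fun hy => hφ ⟨fun h => (hx h).elim, fun h => (hy h).elim⟩⟩
  choose φ hφ₁ hφ₂ using hφ
  have h1 : (InfFormula.ex β hβ (.conj (β → N) φ)).Realize M v := ⟨x, fun y => hφ₁ y⟩
  obtain ⟨y, hy⟩ := (h _).1 h1
  exact hφ₂ y (hy y)

/-- If `(M, v) ≡_{∞,lam} (N, w)` and `v` enumerates a substructure, then `v i ↦ w i` is an
embedding. -/
theorem TupleEquiv.exists_embedding {α : Type u} {v : α → M} {w : α → N}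
    (h : TupleEquiv L lam v w) {B : L.Substructure M} (hB : Set.range v = B) :
    ∃ e : B ↪[L] N, ∀ (x : B) (a : α), (x : M) = v a → e x = w a := by
  have hv : ∀ x : B, ∃ a, v a = x := fun x => hB.ge x.2
  choose a ha using hv
  -- Equality formulas make the value at `x` independent of the index chosen to name `x`.
  have hw : ∀ a b, v a = v b ↔ w a = w b := fun a b => h (.equal (.var a) (.var b))
  have he : ∀ (x : B) (b : α), (x : M) = v b → w (a x) = w b := fun x b hx =>
    (hw _ _).1 ((ha x).trans hx)
  refine ⟨⟨⟨fun x => w (a x), fun x y hxy => ?_⟩, fun {n} f x => ?_, fun {n} R x => ?_⟩, he⟩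
  · exact Subtype.ext ((ha x).symm.trans (((hw _ _).2 hxy).trans (ha y)))
  · refine ((h (.equal (.func f fun i => .var (a (x i))) (.var (a (Structure.funMap f x))))).1
      ?_).symm
    simp only [InfFormula.Realize, Term.realize, ha]
    rfl
  · have := h (.rel R fun i => .var (a (x i)))
    simp only [InfFormula.Realize, Term.realize, ha] at this
    exact this.symm

end Logic
end KuekerAEC

namespace KuekerAEC
namespace StructureClass

variable {L : FirstOrder.Language.{u, u}} {K : StructureClass L}

/-! ### Uniqueness of limit extensions -/

section LimitUniqueness

variable {M N : Type u} [L.Structure M] [L.Structure N]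

theorem IsStrongEmbedding.strongLE_range (hK : K.IsAbstractClass) {A : Type u} [L.Structure A]
    {B : L.Substructure N} {f : A ↪[L] B} (hf : K.IsStrongEmbedding f) :
    K.StrongLE (B.subtype.comp f).toHom.range B := by
  have h := (hK.strongLE_map_iff B.subtype).2 ((strongLE_top_iff hK).2 hf)
  rw [← Hom.range_eq_map, ← Hom.range_comp, Substructure.range_subtype] at h
  exact h

/-- One step of the back-and-forth between two universal extensions. -/
theorem exists_extension_of_universalLE (hK : K.IsAbstractClass) {D D' : L.Substructure M}
    {E E' : L.Substructure N} (hD : K.UniversalLE D D') (hE : K.UniversalLE E E')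
    (hDE : #E = #D) (hD' : #D' = #E) {p : M ≃ₚ[L] N} (hdom : p.dom = D)
    (hcod : K.StrongLE p.cod E) :
    ∃ q : M ≃ₚ[L] N, p ≤ q ∧ q.dom = D' ∧ K.StrongLE q.cod E' ∧ E ≤ q.cod := by
  obtain ⟨dom, cod, e⟩ := p
  subst hdom
  obtain ⟨hDD', huD⟩ := hD
  obtain ⟨hEE', huE⟩ := hE
  let g : dom ↪[L] E := (Substructure.inclusion hcod.1).comp e.toEmbedding
  have hg : K.IsStrongEmbedding g :=
    (isStrongEmbedding_inclusion hcod).comp hK (isStrongEmbedding_equiv hK e huD.1)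
  -- `E` is embedded into `D'` over `D`, then `D'` into `E'` over `E`. The second map therefore
  -- extends `p`, and its range contains `E`, the image of `f(E)`.
  obtain ⟨f, hf, hfg⟩ := huD.2.2 E g hg hDE
  obtain ⟨h, hh, hhf⟩ := huE.2.2 D' f hf hD'
  let k : D' ↪[L] N := E'.subtype.comp h
  refine ⟨⟨D', k.toHom.range, k.equivRange⟩, ⟨hDD', ?_⟩, rfl, hh.strongLE_range hK, ?_⟩
  · ext x
    have h1 : h (f (g x)) = Substructure.inclusion hEE' (g x) := hhf (g x)
    rw [hfg] at h1
    exact congrArg Subtype.val h1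
  · intro y hy
    exact ⟨f ⟨y, hy⟩, congrArg Subtype.val (hhf ⟨y, hy⟩)⟩

/-- The partial isomorphism at stage `i` has domain `D i` and codomain strong in `E (i + 1)`; the
next codomain contains `E (i + 1)`. At limits the codomains interleave with the `E j` and their
union is exactly `E i`, which is strong in `E (i + 1)`. So the invariant survives limits without
smoothness. -/
theorem IsUniversalChain.exists_partialEquiv_iSup (hK : K.IsAbstractClass) {κ : Cardinal.{u}}
    {δ : Ordinal.{u}} (hδ : Order.IsSuccLimit δ) {D : Ordinal.{u} → L.Substructure M}
    {E : Ordinal.{u} → L.Substructure N} (hD : K.IsUniversalChain κ δ D)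
    (hE : K.IsUniversalChain κ δ E) (p : M ≃ₚ[L] N) (hdom : p.dom = D 0) (hcod : p.cod = E 0) :
    ∃ q : M ≃ₚ[L] N, p ≤ q ∧ q.dom = ⨆ i < δ, D i ∧ q.cod = ⨆ i < δ, E i := by
  classical
  have hstep : ∀ (i : Ordinal.{u}) (p : M ≃ₚ[L] N), ∃ q : M ≃ₚ[L] N,
      i < δ → p.dom = D i → K.StrongLE p.cod (E (i + 1)) →
        p ≤ q ∧ q.dom = D (i + 1) ∧ K.StrongLE q.cod (E (i + 1 + 1)) ∧ E (i + 1) ≤ q.cod := by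
    intro i p
    by_cases h : i < δ ∧ p.dom = D i ∧ K.StrongLE p.cod (E (i + 1))
    · have hi := hδ.add_one_lt h.1
      obtain ⟨q, hq⟩ := exists_extension_of_universalLE hK (hD.universal i h.1)
        (hE.universal (i + 1) hi) ((hE.card _ hi).trans (hD.card _ h.1).symm)
        ((hD.card _ hi).trans (hE.card _ hi).symm) h.2.1 h.2.2
      exact ⟨q, fun _ _ _ => hq⟩
    · exact ⟨p, fun h1 h2 h3 => (h ⟨h1, h2, h3⟩).elim⟩
  choose step hstep using hstep
  -- The recursion needs a value before monotonicity is known; the default `p` is irrelevant on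
  -- actual chains.
  let lim : (i : Ordinal.{u}) → ((j : Ordinal.{u}) → j < i → (M ≃ₚ[L] N)) → (M ≃ₚ[L] N) :=
    fun i P => if h : Nonempty (Set.Iio i) ∧ Monotone fun j : Set.Iio i => P j j.2 then
      haveI := h.1
      DirectLimit.partialEquivLimit ⟨fun j : Set.Iio i => P j j.2, h.2⟩ else p
  have hlim : ∀ (i : Ordinal.{u}) (P : Ordinal.{u} → (M ≃ₚ[L] N)), Order.IsSuccLimit i →
      (∀ j k, j ≤ k → k < i → P j ≤ P k) →
      (lim i (fun j _ => P j)).dom = ⨆ j < i, (P j).dom ∧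
      (lim i (fun j _ => P j)).cod = ⨆ j < i, (P j).cod ∧
      ∀ j < i, P j ≤ lim i (fun j _ => P j) := by
    intro i P hi hP
    have h : Nonempty (Set.Iio i) ∧ Monotone fun j : Set.Iio i => P j :=
      ⟨⟨⟨0, hi.bot_lt⟩⟩, fun j k hjk => hP j k hjk k.2⟩
    have := h.1
    have hl : lim i (fun j _ => P j) =
        DirectLimit.partialEquivLimit ⟨fun j : Set.Iio i => P j, h.2⟩ := dif_pos h
    rw [hl]
    refine ⟨?_, ?_, fun j hj => DirectLimit.le_partialEquivLimit
      ⟨fun j : Set.Iio i => P j, h.2⟩ ⟨j, hj⟩⟩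
    · rw [DirectLimit.dom_partialEquivLimit]
      exact iSup_subtype (p := fun j => j < i) (f := fun j => (P j).dom)
    · rw [DirectLimit.cod_partialEquivLimit]
      exact iSup_subtype (p := fun j => j < i) (f := fun j => (P j).cod)
  let P : Ordinal.{u} → (M ≃ₚ[L] N) := fun i =>
    Ordinal.limitRecOn i p (fun i p => step i p) (fun i _ P => lim i P)
  have hP0 : P 0 = p := Ordinal.limitRecOn_zero ..
  have hPs : ∀ i, P (i + 1) = step i (P i) := fun i => Ordinal.limitRecOn_add_one ..
  have hPl : ∀ i, Order.IsSuccLimit i → P i = lim i (fun j _ => P j) := fun i hi =>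
    Ordinal.limitRecOn_limit _ _ _ _ hi
  have hcodsup : ∀ i ≤ δ, Order.IsSuccLimit i →
      (∀ j < i, K.StrongLE (P j).cod (E (j + 1)) ∧ E (j + 1) ≤ (P (j + 1)).cod) →
      ⨆ j < i, (P j).cod = ⨆ j < i, E j := by
    intro i hiδ hi h
    apply le_antisymm
    · exact iSup₂_le fun j hj => (h j hj).1.1.trans
        (le_iSup₂ (f := fun j (_ : j < i) => E j) (j + 1) (hi.add_one_lt hj))
    · refine iSup₂_le fun j hj => ((hE.universal j (hj.trans_le hiδ)).1.trans (h j hj).2).trans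
        (le_iSup₂ (f := fun j (_ : j < i) => (P j).cod) (j + 1) (hi.add_one_lt hj))
  have key : ∀ i < δ, (P i).dom = D i ∧ K.StrongLE (P i).cod (E (i + 1)) ∧
      ∀ j ≤ i, P j ≤ P i := by
    intro i
    induction i using Ordinal.limitRecOn with
    | zero =>
      intro h0
      refine ⟨hP0 ▸ hdom, ?_, fun j hj => ?_⟩
      · rw [hP0, hcod]
        exact (hE.universal 0 h0).strongLE hK
      · rw [nonpos_iff_eq_zero.1 hj]
    | add_one i ih =>
      intro hi
      have hi' : i < δ := (lt_add_one i).trans hi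
      obtain ⟨h1, h2, h3⟩ := ih hi'
      obtain ⟨g1, g2, g3, -⟩ := hstep i (P i) hi' h1 h2
      rw [← hPs] at g1 g2 g3
      refine ⟨g2, g3, fun j hj => ?_⟩
      rcases hj.lt_or_eq with hj | rfl
      · exact (h3 j (Order.lt_add_one_iff.1 hj)).trans g1
      · exact le_rfl
    | limit i hi ih =>
      intro hiδ
      obtain ⟨g1, g2, g3⟩ := hlim i P hi fun j k hjk hk => (ih k hk (hk.trans hiδ)).2.2 j hjk
      rw [← hPl i hi] at g1 g2 g3
      refine ⟨?_, ?_, fun j hj => ?_⟩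
      · rw [g1, hD.cont.cont i hiδ hi]
        exact biSup_congr fun j hj => (ih j hj (hj.trans hiδ)).1
      · rw [g2, hcodsup i hiδ.le hi, ← hE.cont.cont i hiδ hi]
        · exact (hE.universal i hiδ).strongLE hK
        · intro j hj
          obtain ⟨h1, h2, -⟩ := ih j hj (hj.trans hiδ)
          exact ⟨h2, by
            rw [hPs]
            exact (hstep j (P j) (hj.trans hiδ) h1 h2).2.2.2⟩
      · rcases hj.lt_or_eq with hj | rfl
        · exact g3 j hj
        · exact le_rfl
  obtain ⟨g1, g2, g3⟩ := hlim δ P hδ fun j k hjk hk => (key k hk).2.2 j hjk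
  refine ⟨_, hP0 ▸ g3 0 hδ.bot_lt, ?_, ?_⟩
  · rw [g1]
    exact biSup_congr fun j hj => (key j hj).1
  · rw [g2]
    refine hcodsup δ le_rfl hδ fun j hj => ?_
    obtain ⟨h1, h2, -⟩ := key j hj
    exact ⟨h2, by
      rw [hPs]
      exact (hstep j (P j) hj h1 h2).2.2.2⟩

/-- Limit models over isomorphic structures are isomorphic. -/
theorem IsLimitOver.exists_partialEquiv (hK : K.IsAbstractClass) {κ : Cardinal.{u}}
    {δ : Ordinal.{u}} (hδ : Order.IsSuccLimit δ) {A B : L.Substructure M}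
    {A' B' : L.Substructure N} (h : K.IsLimitOver κ δ B A) (h' : K.IsLimitOver κ δ B' A')
    (p : M ≃ₚ[L] N) (hdom : p.dom = A) (hcod : p.cod = A') :
    ∃ q : M ≃ₚ[L] N, p ≤ q ∧ q.dom = B ∧ q.cod = B' := by
  obtain ⟨-, D, hD, rfl, rfl⟩ := isLimitOver_iff.1 h
  obtain ⟨-, E, hE, rfl, rfl⟩ := isLimitOver_iff.1 h'
  exact hD.exists_partialEquiv_iSup hK hδ hE p hdom hcod

end LimitUniqueness

end StructureClass
end KuekerAEC

namespace KuekerAEC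

/-! ### Coding structures by diagrams on a fixed set, so that unions of chains are unions of sets -/

section Code

variable {L : FirstOrder.Language.{u, u}} {Ω : Type u}

/-- The diagram of a structure living on a subset of `Ω`. -/
@[ext]
structure Diagram (L : FirstOrder.Language.{u, u}) (Ω : Type u) where
  carrier : Set Ω
  fn : ∀ n, L.Functions n → Set ((Fin n → Ω) × Ω)
  rl : ∀ n, L.Relations n → Set (Fin n → Ω)

namespace Diagram

/-- The diagram of the image of a structure under a map to `Ω`. -/
def of {M : Type u} [L.Structure M] (j : M → Ω) : Diagram L Ω where
  carrier := Set.range j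
  fn n f := Set.range fun x : Fin n → M => (j ∘ x, j (Structure.funMap f x))
  rl n r := {y | ∃ x : Fin n → M, Structure.RelMap r x ∧ j ∘ x = y}

/-- The union of a family of diagrams. -/
def union {ι : Type*} (d : ι → Diagram L Ω) : Diagram L Ω where
  carrier := ⋃ i, (d i).carrier
  fn n f := ⋃ i, (d i).fn n f
  rl n r := ⋃ i, (d i).rl n r

variable {M N P : Type u} [L.Structure M] [L.Structure N] [L.Structure P]

theorem carrier_of_comp_subset (i : M ↪[L] N) (j : N → Ω) :
    (of (L := L) (j ∘ i)).carrier ⊆ (of (L := L) j).carrier := by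
  rintro _ ⟨x, rfl⟩
  exact ⟨i x, rfl⟩

theorem fn_of_comp_subset (i : M ↪[L] N) (j : N → Ω) {n : ℕ} (f : L.Functions n) :
    (of (j ∘ i)).fn n f ⊆ (of j).fn n f := by
  rintro _ ⟨x, rfl⟩
  refine ⟨i ∘ x, ?_⟩
  simp only [Function.comp_apply, i.map_fun]
  rfl

theorem rl_of_comp_subset (i : M ↪[L] N) (j : N → Ω) {n : ℕ} (r : L.Relations n) :
    (of (j ∘ i)).rl n r ⊆ (of j).rl n r := by
  rintro _ ⟨x, hx, rfl⟩
  exact ⟨i ∘ x, (i.map_rel r x).2 hx, rfl⟩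

theorem of_comp_equiv (e : M ≃[L] N) (j : N → Ω) : of (L := L) (j ∘ e) = of j := by
  have h : (j ∘ e) ∘ e.symm.toEmbedding = j := by
    ext x
    simp
  ext1
  · refine (carrier_of_comp_subset e.toEmbedding j).antisymm ?_
    conv_lhs => rw [← h]
    exact carrier_of_comp_subset e.symm.toEmbedding _
  · ext1 n
    ext1 f
    refine (fn_of_comp_subset e.toEmbedding j f).antisymm ?_
    conv_lhs => rw [← h]
    exact fn_of_comp_subset e.symm.toEmbedding _ f
  · ext1 n
    ext1 r
    refine (rl_of_comp_subset e.toEmbedding j r).antisymm ?_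
    conv_lhs => rw [← h]
    exact rl_of_comp_subset e.symm.toEmbedding _ r

/-- An injective coding loses nothing: the diagram determines the structure up to an isomorphism
commuting with the codings. -/
theorem exists_equiv_of_eq {j : M → Ω} {j' : N → Ω} (hj : j.Injective) (hj' : j'.Injective)
    (h : of (L := L) j = of j') : ∃ e : M ≃[L] N, ∀ x, j' (e x) = j x := by
  have hc : Set.range j = Set.range j' := congrArg carrier h
  let e : M ≃ N := (Equiv.ofInjective j hj).trans
    ((Equiv.setCongr hc).trans (Equiv.ofInjective j' hj').symm)
  have he : ∀ x, j' (e x) = j x := by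
    intro x
    have := Equiv.apply_ofInjective_symm hj' (Equiv.setCongr hc (Equiv.ofInjective j hj x))
    simpa [e] using this
  have he' : ∀ {n : ℕ} (x : Fin n → M), j' ∘ (e ∘ x) = j ∘ x := fun x => funext fun k => he _
  refine ⟨⟨e, fun {n} f x => hj' ?_, fun {n} r x => ?_⟩, he⟩
  · have h1 : (j ∘ x, j (Structure.funMap f x)) ∈ (of j').fn n f := h ▸ ⟨x, rfl⟩
    obtain ⟨y, hy⟩ := h1
    obtain ⟨hy1, hy2⟩ := Prod.mk.injEq .. ▸ hy
    rw [← he'] at hy1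
    rw [hj'.comp_left hy1] at hy2
    exact (he _).trans hy2.symm
  · constructor
    · intro hx
      have h1 : j ∘ x ∈ (of j).rl n r := h ▸ ⟨e ∘ x, hx, he' x⟩
      obtain ⟨y, hy, hyx⟩ := h1
      exact hj.comp_left hyx ▸ hy
    · intro hx
      have h1 : j ∘ x ∈ (of j').rl n r := h ▸ ⟨x, hx, rfl⟩
      obtain ⟨y, hy, hyx⟩ := h1
      rw [← he'] at hyx
      exact hj'.comp_left hyx ▸ hy

/-- `d'` is the diagram of an extension of the structure with diagram `d`. -/
def Sub (d d' : Diagram L Ω) : Prop :=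
  ∃ (A B : Type u) (_ : L.Structure A) (_ : L.Structure B) (i : A ↪[L] B) (j : B → Ω),
    j.Injective ∧ d = of (j ∘ i) ∧ d' = of j

theorem sub_refl_of {j : M → Ω} (hj : j.Injective) : Sub (of (L := L) j) (of j) :=
  ⟨M, M, _, _, .refl L M, j, hj, rfl, rfl⟩

/-- `Sub d d` expresses that `d` is the diagram of an actual structure; arbitrary diagrams need not
satisfy it. -/
theorem Sub.refl_left {d d' : Diagram L Ω} (h : Sub d d') : Sub d d := by
  obtain ⟨A, B, _, _, i, j, hj, rfl, rfl⟩ := h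
  exact sub_refl_of (hj.comp i.injective)

theorem Sub.refl_right {d d' : Diagram L Ω} (h : Sub d d') : Sub d' d' := by
  obtain ⟨A, B, _, _, i, j, hj, rfl, rfl⟩ := h
  exact sub_refl_of hj

theorem Sub.trans {d d' d'' : Diagram L Ω} (h : Sub d d') (h' : Sub d' d'') : Sub d d'' := by
  obtain ⟨A, B, _, _, i, j, hj, rfl, rfl⟩ := h
  obtain ⟨A', B', _, _, i', j', hj', h1, rfl⟩ := h'
  obtain ⟨e, he⟩ := exists_equiv_of_eq hj (hj'.comp i'.injective) h1
  refine ⟨A, B', _, _, i'.comp (e.toEmbedding.comp i), j', hj', ?_, rfl⟩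
  congr 1
  ext x
  exact (he (i x)).symm

theorem Sub.carrier_subset {d d' : Diagram L Ω} (h : Sub d d') : d.carrier ⊆ d'.carrier := by
  obtain ⟨A, B, _, _, i, j, hj, rfl, rfl⟩ := h
  exact carrier_of_comp_subset i j

theorem Sub.fn_subset {d d' : Diagram L Ω} (h : Sub d d') {n : ℕ} (f : L.Functions n) :
    d.fn n f ⊆ d'.fn n f := by
  obtain ⟨A, B, _, _, i, j, hj, rfl, rfl⟩ := h
  exact fn_of_comp_subset i j f

theorem Sub.fn_unique {d : Diagram L Ω} (h : Sub d d) {n : ℕ} {f : L.Functions n}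
    {x : Fin n → Ω} {y y' : Ω} (hy : (x, y) ∈ d.fn n f) (hy' : (x, y') ∈ d.fn n f) : y = y' := by
  obtain ⟨A, B, _, _, i, j, hj, -, rfl⟩ := h
  obtain ⟨a, ha⟩ := hy
  obtain ⟨b, hb⟩ := hy'
  obtain ⟨ha1, rfl⟩ := Prod.mk.injEq .. ▸ ha
  obtain ⟨hb1, rfl⟩ := Prod.mk.injEq .. ▸ hb
  rw [hj.comp_left (ha1.trans hb1.symm)]

theorem Sub.rl_iff {d d' : Diagram L Ω} (h : Sub d d') {n : ℕ} (r : L.Relations n)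
    {x : Fin n → Ω} (hx : ∀ k, x k ∈ d.carrier) : x ∈ d.rl n r ↔ x ∈ d'.rl n r := by
  obtain ⟨A, B, _, _, i, j, hj, rfl, rfl⟩ := h
  refine ⟨fun h => rl_of_comp_subset i j r h, ?_⟩
  rintro ⟨b, hb, rfl⟩
  choose a ha using hx
  have : i ∘ a = b := hj.comp_left (funext ha)
  exact ⟨a, (i.map_rel r a).1 (this ▸ hb), funext ha⟩

/-- A chain of diagrams is realized by a chain of substructures of a single structure. -/
theorem exists_structure_of_chain [Nonempty Ω] {ι : Type*} [LinearOrder ι]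
    (d : ι → Diagram L Ω) (hd : ∀ i k, i ≤ k → Sub (d i) (d k)) :
    ∃ _ : L.Structure Ω, ∀ i, ∃ A : L.Substructure Ω, d i = of A.subtype := by
  classical
  -- Arguments outside the union graph get an arbitrary value; this is harmless because each coded
  -- structure is already closed under its functions.
  let S : L.Structure Ω :=
    { funMap := fun {n} f x => if h : ∃ y, (x, y) ∈ (union d).fn n f then h.choose
        else Classical.arbitrary Ω
      RelMap := fun {n} r x => x ∈ (union d).rl n r }
  have hfun : ∀ {n : ℕ} (f : L.Functions n) (x : Fin n → Ω) (y : Ω) (i : ι),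
      (x, y) ∈ (d i).fn n f → Structure.funMap f x = y := by
    intro n f x y i hy
    have h : ∃ y, (x, y) ∈ (union d).fn n f := ⟨y, Set.mem_iUnion.2 ⟨i, hy⟩⟩
    have h1 : Structure.funMap f x = h.choose := dif_pos h
    obtain ⟨k, hk⟩ := Set.mem_iUnion.1 h.choose_spec
    rw [h1]
    rcases le_total i k with hik | hik
    · exact (hd i k hik).refl_right.fn_unique hk ((hd i k hik).fn_subset f hy)
    · exact (hd k i hik).refl_right.fn_unique ((hd k i hik).fn_subset f hk) hy
  have hrel : ∀ {n : ℕ} (r : L.Relations n) (x : Fin n → Ω) (i : ι),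
      (∀ l, x l ∈ (d i).carrier) → (x ∈ (d i).rl n r ↔ Structure.RelMap r x) := by
    intro n r x i hx
    refine ⟨fun h => Set.mem_iUnion.2 ⟨i, h⟩, fun h => ?_⟩
    obtain ⟨k, hk⟩ := Set.mem_iUnion.1 h
    rcases le_total i k with hik | hik
    · exact ((hd i k hik).rl_iff r hx).2 hk
    -- Here `k ≤ i`: a tuple related in `d k` has its coordinates in the carrier of `d k`, so the
    -- relation passes up to `d i`.
    · have hx' : ∀ l, x l ∈ (d k).carrier := by
        obtain ⟨A, B, _, _, a, b, hb, -, h2⟩ := (hd k i hik).refl_left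
        rw [h2] at hk ⊢
        obtain ⟨z, -, rfl⟩ := hk
        exact fun l => ⟨z l, rfl⟩
      exact ((hd k i hik).rl_iff r hx').1 hk
  refine ⟨S, fun i => ?_⟩
  obtain ⟨-, B, -, _, -, j, hj, -, hi⟩ := hd i i le_rfl
  let J : B ↪[L] Ω := ⟨⟨j, hj⟩, fun {n} f x => (hfun f _ _ i (hi ▸ ⟨x, rfl⟩)).symm,
    fun {n} r x => (hrel r _ i (fun l => hi ▸ ⟨x l, rfl⟩)).symm.trans ⟨fun h => by
      rw [hi] at h
      obtain ⟨y, hy, hyx⟩ := h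
      exact hj.comp_left hyx ▸ hy, fun h => hi ▸ ⟨x, h, rfl⟩⟩⟩
  refine ⟨J.toHom.range, hi.trans ?_⟩
  rw [← of_comp_equiv J.equivRange]
  rfl

theorem coe_eq_carrier [L.Structure Ω] {d : Diagram L Ω} {A : L.Substructure Ω}
    (h : d = of A.subtype) : (A : Set Ω) = d.carrier := by
  rw [h]
  exact Subtype.range_coe.symm

theorem sub_of_le [L.Structure Ω] {A B : L.Substructure Ω} (h : A ≤ B) :
    Sub (of (L := L) A.subtype) (of B.subtype) :=
  ⟨A, B, _, _, Substructure.inclusion h, B.subtype, B.subtype.injective, rfl, rfl⟩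

/-- Once the chain is realized by substructures of one structure on `Ω`, the union is the diagram of
their supremum: arities are finite, so every tuple of the supremum lies in one stage. -/
theorem sub_union [Nonempty Ω] {ι : Type*} [LinearOrder ι] [Nonempty ι]
    (d : ι → Diagram L Ω) (hd : ∀ i k, i ≤ k → Sub (d i) (d k)) (i : ι) :
    Sub (d i) (union d) := by
  obtain ⟨S, hS⟩ := exists_structure_of_chain d hd
  choose A hA using hS
  have hmono : Monotone A := fun i k hik => by
    rw [← SetLike.coe_subset_coe, coe_eq_carrier (hA i), coe_eq_carrier (hA k)]
    exact (hd i k hik).carrier_subset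
  have hmem : ∀ x, x ∈ ⨆ i, A i ↔ ∃ i, x ∈ A i := fun x =>
    Substructure.mem_iSup_of_directed hmono.directed_le
  have hU : union d = of (⨆ i, A i : L.Substructure Ω).subtype := by
    have hsub : ∀ i, Sub (d i) (of (⨆ i, A i : L.Substructure Ω).subtype) := fun i => by
      rw [hA i]
      exact sub_of_le (le_iSup A i)
    have hfin : ∀ {n : ℕ} (x : Fin n → (⨆ i, A i : L.Substructure Ω)), ∃ i, ∀ k,
        (x k : Ω) ∈ A i := by
      intro n x
      choose i hi using fun k => (hmem (x k)).1 (x k).2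
      obtain ⟨m, hm⟩ := Finite.exists_le i
      exact ⟨m, fun k => hmono (hm k) (hi k)⟩
    ext1
    · refine (Set.iUnion_subset fun i => (hsub i).carrier_subset).antisymm ?_
      rintro _ ⟨x, rfl⟩
      obtain ⟨i, hi⟩ := (hmem x).1 x.2
      exact Set.mem_iUnion.2 ⟨i, (coe_eq_carrier (hA i)).le hi⟩
    · ext1 n
      ext1 f
      refine (Set.iUnion_subset fun i => (hsub i).fn_subset f).antisymm ?_
      rintro _ ⟨x, rfl⟩
      obtain ⟨i, hi⟩ := hfin x
      refine Set.mem_iUnion.2 ⟨i, ?_⟩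
      rw [hA i]
      exact ⟨fun k => ⟨x k, hi k⟩, rfl⟩
    · ext1 n
      ext1 r
      refine (Set.iUnion_subset fun i y hy => ?_).antisymm ?_
      · rw [hA i] at hy
        exact rl_of_comp_subset (Substructure.inclusion (le_iSup A i)) _ r hy
      · rintro _ ⟨x, hx, rfl⟩
        obtain ⟨i, hi⟩ := hfin x
        refine Set.mem_iUnion.2 ⟨i, ?_⟩
        rw [hA i]
        exact ⟨fun k => ⟨x k, hi k⟩, hx, rfl⟩
  rw [hA i, hU]
  exact sub_of_le (le_iSup A i)

end Diagram

end Code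
end KuekerAEC

/-! ### Construction of universal chains of length `κ⁺` -/

namespace KuekerAEC

/-- The range of `j` is smaller than `Ω`, so its complement still has size `#Ω` and can receive the
new points. -/
theorem exists_injective_extension {A B Ω : Type u} {i : A → B} (hi : i.Injective) {j : A → Ω}
    (hj : j.Injective) (hΩ : ℵ₀ ≤ #Ω) (hA : #A < #Ω) (hB : #B ≤ #Ω) :
    ∃ j' : B → Ω, j'.Injective ∧ j' ∘ i = j := by
  classical
  have : Infinite Ω := infinite_iff.2 hΩ
  have hcompl : #((Set.range j)ᶜ : Set Ω) = #Ω :=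
    mk_compl_of_infinite _ (mk_range_le.trans_lt hA)
  obtain ⟨g⟩ : Nonempty (B ↪ ((Set.range j)ᶜ : Set Ω)) := (hB.trans hcompl.ge)
  let j' : B → Ω := fun b => if h : ∃ a, i a = b then j h.choose else g b
  have h1 : ∀ a, j' (i a) = j a := fun a => by
    have h : ∃ a', i a' = i a := ⟨a, rfl⟩
    have h2 : j' (i a) = j h.choose := dif_pos h
    rw [h2, hi h.choose_spec]
  have h2 : ∀ b, (¬ ∃ a, i a = b) → j' b = g b := fun b h => dif_neg h
  refine ⟨j', fun b b' hb => ?_, funext h1⟩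
  by_cases h : ∃ a, i a = b <;> by_cases h' : ∃ a, i a = b'
  · obtain ⟨a, rfl⟩ := h
    obtain ⟨a', rfl⟩ := h'
    rw [h1, h1] at hb
    rw [hj hb]
  · obtain ⟨a, rfl⟩ := h
    rw [h1, h2 _ h'] at hb
    exact ((g b').2 ⟨a, hb⟩).elim
  · obtain ⟨a, rfl⟩ := h'
    rw [h1, h2 _ h] at hb
    exact ((g b).2 ⟨a, hb.symm⟩).elim
  · rw [h2 _ h, h2 _ h'] at hb
    exact g.injective (Subtype.ext hb)

namespace StructureClass

variable {L : FirstOrder.Language.{u, u}} {K : StructureClass L}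

open Diagram

/-- `d'` is the diagram of a universal extension in `K_κ` of the structure with diagram `d`. -/
def UniversalSub (K : StructureClass L) (κ : Cardinal.{u}) {Ω : Type u} (d d' : Diagram L Ω) :
    Prop :=
  ∃ (A B : Type u) (_ : L.Structure A) (_ : L.Structure B) (i : A ↪[L] B) (j : B → Ω),
    j.Injective ∧ K.IsUniversalOver i ∧ #B = κ ∧ d = of (j ∘ i) ∧ d' = of j

theorem UniversalSub.sub {κ : Cardinal.{u}} {Ω : Type u} {d d' : Diagram L Ω}
    (h : K.UniversalSub κ d d') : Sub d d' := by
  obtain ⟨A, B, _, _, i, j, hj, -, -, h1, h2⟩ := h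
  exact ⟨A, B, _, _, i, j, hj, h1, h2⟩

theorem IsStronglyCategorical.exists_universalSub {κ : Cardinal.{u}}
    (hcat : K.IsStronglyCategorical κ) (hκ : ℵ₀ ≤ κ) {Ω A : Type u} (hΩ : #Ω = Order.succ κ)
    [L.Structure A] (hA : K.Mem A) (hAκ : #A = κ) {j : A → Ω} (hj : j.Injective) :
    ∃ d' : Diagram L Ω, K.UniversalSub κ (of j) d' := by
  obtain ⟨B, _, i, hB, hi⟩ := hcat.exists_universal A hA hAκ
  have hlt : κ < #Ω := hΩ ▸ Order.lt_succ κ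
  obtain ⟨j', hj', rfl⟩ := exists_injective_extension i.injective hj (hκ.trans hlt.le)
    (hAκ.trans_lt hlt) (hB.trans_le hlt.le)
  exact ⟨of j', A, B, _, _, i, j', hj', hi, hB, rfl, rfl⟩

theorem UniversalSub.universalLE (hK : K.IsAbstractClass) {κ : Cardinal.{u}} {Ω : Type u}
    [L.Structure Ω] {A B : L.Substructure Ω} (hAB : A ≤ B)
    (h : K.UniversalSub κ (of A.subtype) (of B.subtype)) : K.UniversalLE A B ∧ #B = κ := by
  obtain ⟨A', B', _, _, i, j, hj, hi, hB, h1, h2⟩ := h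
  obtain ⟨eA, heA⟩ := exists_equiv_of_eq (hj.comp i.injective) A.subtype.injective h1.symm
  obtain ⟨eB, heB⟩ := exists_equiv_of_eq hj B.subtype.injective h2.symm
  refine ⟨⟨hAB, hi.congr hK eA eB fun a => Subtype.ext ?_⟩,
    (mk_congr eB.toEquiv).symm.trans hB⟩
  exact (heA a).trans (heB (i a)).symm

theorem IsContChain.mem_iSup_iff {M : Type u} [L.Structure M]
    {D : Ordinal.{u} → L.Substructure M} {δ : Ordinal.{u}} (hD : K.IsContChain δ D)
    (hδ : Order.IsSuccLimit δ) {x : M} :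
    x ∈ (⨆ i < δ, D i : L.Substructure M) ↔ ∃ i < δ, x ∈ D i := by
  have hne : Nonempty (Set.Iio δ) := ⟨⟨0, hδ.bot_lt⟩⟩
  have hmono : Monotone fun i : Set.Iio δ => D i := fun i j hij => (hD.strong i j hij j.2).1
  rw [← iSup_subtype (p := fun i => i < δ) (f := fun i => D i)]
  refine (Substructure.mem_iSup_of_directed hmono.directed_le).trans ?_
  exact ⟨fun ⟨i, hi⟩ => ⟨i, i.2, hi⟩, fun ⟨i, hi, hx⟩ => ⟨⟨i, hi⟩, hx⟩⟩

theorem card_iSup_of_isContChain {M : Type u} [L.Structure M] {κ : Cardinal.{u}} (hκ : ℵ₀ ≤ κ)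
    {δ : Ordinal.{u}} (hδ : Order.IsSuccLimit δ) (hδκ : δ < (Order.succ κ).ord)
    {D : Ordinal.{u} → L.Substructure M} (hD : K.IsContChain δ D) (hc : ∀ i < δ, #(D i) = κ) :
    #(⨆ i < δ, D i : L.Substructure M) = κ := by
  apply le_antisymm
  · have hsub : ((⨆ i < δ, D i : L.Substructure M) : Set M) ⊆ ⋃ i < δ, (D i : Set M) := by
      intro x hx
      obtain ⟨i, hi, hx⟩ := (hD.mem_iSup_iff hδ).1 hx
      exact Set.mem_iUnion₂.2 ⟨i, hi, hx⟩
    refine (mk_le_mk_of_subset hsub).trans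
      (mk_biUnion_le_of_le (Order.lt_succ_iff.1 (lt_ord.1 hδκ)) hκ _ fun i hi => ?_)
    exact (hc i hi).le
  · rw [← hc 0 hδ.bot_lt]
    exact mk_le_mk_of_subset (le_iSup₂ (f := fun i (_ : i < δ) => D i) 0 hδ.bot_lt)

/-- Every structure in `K_κ` starts a universal chain of length `κ⁺`. -/
theorem IsWeakAEC.exists_isUniversalChain {μ κ : Cardinal.{u}} (hK : K.IsWeakAEC μ)
    (hcat : K.IsStronglyCategorical κ) (hκ : ℵ₀ ≤ κ) {A : Type u} [L.Structure A]
    (hA : K.Mem A) (hAκ : #A = κ) :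
    ∃ (M : Type u) (_ : L.Structure M) (D : Ordinal.{u} → L.Substructure M),
      #M = Order.succ κ ∧ K.IsUniversalChain κ (Order.succ κ).ord D ∧ Nonempty (A ≃[L] D 0) := by
  classical
  set θ := (Order.succ κ).ord with hθ
  have hθl : Order.IsSuccLimit θ := isSuccLimit_ord (hκ.trans (Order.le_succ κ))
  let Ω : Type u := (Order.succ κ).out
  have hΩ : #Ω = Order.succ κ := mk_out _
  have : Nonempty Ω := mk_ne_zero_iff.1 (by
    rw [hΩ]
    exact (Order.bot_lt_succ κ).ne')
  obtain ⟨j⟩ : Nonempty (A ↪ Ω) := by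
    rw [← Cardinal.le_def, hΩ, hAκ]
    exact Order.le_succ κ
  -- If `d` has no universal extension, the step stays at `d`. It is thus total, preserves `Sub`,
  -- and is universal whenever `d` codes a member of `K_κ`.
  have hstep : ∀ d : Diagram L Ω, ∃ d', (Sub d d → Sub d d') ∧
      ∀ (B : Type u) (_ : L.Structure B) (j : B → Ω), j.Injective → d = of j → K.Mem B →
        #B = κ → K.UniversalSub κ d d' := by
    intro d
    by_cases h : ∃ d', K.UniversalSub κ d d'
    · obtain ⟨d', hd'⟩ := h
      exact ⟨d', fun _ => hd'.sub, fun _ _ _ _ _ _ _ => hd'⟩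
    · refine ⟨d, id, fun B _ j hj hd hB hBκ => (h ?_).elim⟩
      rw [hd]
      exact hcat.exists_universalSub hκ hΩ hB hBκ hj
  choose step hstep hstep' using hstep
  let R : Ordinal.{u} → Diagram L Ω := fun i => Ordinal.limitRecOn i (of j)
    (fun _ d => step d) (fun i _ R => Diagram.union fun k : Set.Iio i => R k k.2)
  have hR0 : R 0 = of j := Ordinal.limitRecOn_zero ..
  have hRs : ∀ i, R (i + 1) = step (R i) := fun i => Ordinal.limitRecOn_add_one ..
  have hRl : ∀ i, Order.IsSuccLimit i → R i = Diagram.union fun k : Set.Iio i => R k :=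
    fun i hi => Ordinal.limitRecOn_limit _ _ _ _ hi
  -- The diagrams form a chain of extensions at all ordinals; membership in `K` and size `κ` are
  -- claimed only below `κ⁺`.
  have hsub : ∀ i k, k ≤ i → Sub (R k) (R i) := by
    intro i
    induction i using Ordinal.limitRecOn with
    | zero =>
      intro k hk
      rw [nonpos_iff_eq_zero.1 hk, hR0]
      exact sub_refl_of j.injective
    | add_one i ih =>
      have h : Sub (R i) (R (i + 1)) := by
        rw [hRs]
        exact hstep _ (ih i le_rfl)
      intro k hk
      rcases hk.lt_or_eq with hk | rfl
      · exact (ih k (Order.lt_add_one_iff.1 hk)).trans h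
      · exact h.refl_right
    | limit i hi ih =>
      have : Nonempty (Set.Iio i) := ⟨⟨0, hi.bot_lt⟩⟩
      have h : ∀ k < i, Sub (R k) (R i) := fun k hk => by
        rw [hRl i hi]
        exact sub_union (fun k : Set.Iio i => R k) (fun a b hab => ih b b.2 a hab) ⟨k, hk⟩
      intro k hk
      rcases hk.lt_or_eq with hk | rfl
      · exact h k hk
      · exact (h 0 hi.bot_lt).refl_right
  obtain ⟨S, hS⟩ := exists_structure_of_chain R fun i k hik => hsub k i hik
  choose D hD using hS
  have hcar : ∀ i, (D i : Set Ω) = (R i).carrier := fun i => coe_eq_carrier (hD i)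
  have hmono : ∀ i k, i ≤ k → D i ≤ D k := fun i k hik => by
    rw [← SetLike.coe_subset_coe, hcar, hcar]
    exact (hsub k i hik).carrier_subset
  have hcont : ∀ i, Order.IsSuccLimit i → D i = ⨆ k < i, D k := by
    intro i hi
    refine le_antisymm ?_ (iSup₂_le fun k hk => hmono k i hk.le)
    intro x hx
    have hx' : x ∈ (R i).carrier := (hcar i).le hx
    rw [hRl i hi] at hx'
    obtain ⟨k, hk⟩ := Set.mem_iUnion.1 hx'
    exact le_iSup₂ (f := fun k (_ : k < i) => D k) k.1 k.2 ((hcar k).ge hk)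
  obtain ⟨e₀, -⟩ := exists_equiv_of_eq j.injective (D 0).subtype.injective
    (hR0.symm.trans (hD 0))
  have huniv : ∀ i, K.Mem (D i) → #(D i) = κ →
      K.UniversalLE (D i) (D (i + 1)) ∧ #(D (i + 1)) = κ := by
    intro i hi hiκ
    have h := hstep' (R i) (D i) _ _ (D i).subtype.injective (hD i) hi hiκ
    rw [← hRs, hD i, hD (i + 1)] at h
    exact h.universalLE hK.toIsAbstractClass (hmono _ _ (le_add_of_nonneg_right zero_le_one))
  have key : ∀ i < θ, K.Mem (D i) ∧ #(D i) = κ ∧ ∀ k ≤ i, K.StrongLE (D k) (D i) := by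
    intro i
    induction i using Ordinal.limitRecOn with
    | zero =>
      intro _
      have hm := hK.mem_iso _ _ e₀ hA
      refine ⟨hm, (mk_congr e₀.toEquiv).symm.trans hAκ, fun k hk => ?_⟩
      rw [nonpos_iff_eq_zero.1 hk]
      exact hK.strongLE_refl hm
    | add_one i ih =>
      intro hi
      obtain ⟨h1, h2, h3⟩ := ih ((lt_add_one i).trans hi)
      obtain ⟨g1, g2⟩ := huniv i h1 h2
      refine ⟨g1.2.2.1, g2, fun k hk => ?_⟩
      rcases hk.lt_or_eq with hk | rfl
      · exact hK.strongLE_trans (h3 k (Order.lt_add_one_iff.1 hk))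
          (g1.strongLE hK.toIsAbstractClass)
      · exact hK.strongLE_refl g1.2.2.1
    | limit i hi ih =>
      intro hiθ
      have hchain : K.IsContChain i D :=
        ⟨fun k hk => (ih k hk (hk.trans hiθ)).1,
          fun k l hkl hl => (ih l hl (hl.trans hiθ)).2.2 k hkl, fun k _ hkl => hcont k hkl⟩
      have hm := hK.union_mem _ i D hi hchain
      refine ⟨hcont i hi ▸ hm, ?_, fun k hk => ?_⟩
      · rw [hcont i hi]
        exact card_iSup_of_isContChain hκ hi hiθ hchain fun k hk => (ih k hk (hk.trans hiθ)).2.1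
      · rcases hk.lt_or_eq with hk | rfl
        · have := hK.strong_union _ i D hi hchain k hk
          rwa [← hcont i hi] at this
        · exact hK.strongLE_refl (hcont k hi ▸ hm)
  refine ⟨Ω, S, D, hΩ, ⟨⟨fun i hi => (key i hi).1, fun i k hik hk => (key k hk).2.2 i hik,
    fun i _ hil => hcont i hil⟩, fun i hi => (huniv i (key i hi).1 (key i hi).2.1).1,
    fun i hi => (key i hi).2.1⟩, ⟨e₀⟩⟩

/-! ### Chains of length `κ⁺` and the structure of size `κ⁺` -/

section LongChain

variable {M : Type u} [L.Structure M] {κ : Cardinal.{u}} {D : Ordinal.{u} → L.Substructure M}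

/-- Small subsets of the union of a chain of length `κ⁺` are contained in a member. -/
theorem IsContChain.exists_subset (hκ : ℵ₀ ≤ κ) (hD : K.IsContChain (Order.succ κ).ord D)
    {C : Set M} (hC : #C ≤ κ)
    (hsub : C ⊆ (⨆ i < (Order.succ κ).ord, D i : L.Substructure M)) :
    ∃ i < (Order.succ κ).ord, C ⊆ D i := by
  have hl : Order.IsSuccLimit (Order.succ κ).ord := isSuccLimit_ord (hκ.trans (Order.le_succ κ))
  choose i hi hi' using fun c : C => (hD.mem_iSup_iff hl).1 (hsub c.2)
  have hlt : ⨆ c, i c < (Order.succ κ).ord := by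
    refine Ordinal.iSup_lt_of_lt_cof ?_ hi
    rw [(isRegular_succ hκ).cof_ord]
    exact Order.lt_succ_iff.2 hC
  exact ⟨_, hlt, fun c hc => (hD.strong _ _ (Ordinal.le_iSup i ⟨c, hc⟩) hlt).1 (hi' ⟨c, hc⟩)⟩

/-- A union of size at most `κ` would be contained in some `D i`, yet `D (i + 1)` has points outside
`D i`. -/
theorem IsUniversalChain.card_iSup (hκ : ℵ₀ ≤ κ) (hcat : K.IsStronglyCategorical κ)
    (hM : #M = Order.succ κ) (hD : K.IsUniversalChain κ (Order.succ κ).ord D) :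
    #(⨆ i < (Order.succ κ).ord, D i : L.Substructure M) = Order.succ κ := by
  have hl : Order.IsSuccLimit (Order.succ κ).ord := isSuccLimit_ord (hκ.trans (Order.le_succ κ))
  refine ((mk_subtype_le _).trans hM.le).antisymm (Order.succ_le_iff.2 (not_le.1 fun h => ?_))
  obtain ⟨i, hi, hsub⟩ := hD.cont.exists_subset hκ h subset_rfl
  obtain ⟨x, hx, hx'⟩ := (hD.universal i hi).exists_notMem hcat (hD.card i hi)
  exact hx' (hsub ((hD.cont.mem_iSup_iff hl).2 ⟨i + 1, hl.add_one_lt hi, hx⟩))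

/-- The structure of size `κ⁺` is the union of a universal chain starting with any given
structure in `K_κ`. -/
theorem IsWeakAEC.exists_isUniversalChain_of_card {μ : Cardinal.{u}} (hK : K.IsWeakAEC μ)
    (hcat : K.IsStronglyCategorical κ) (hκ : ℵ₀ ≤ κ) {A F : Type u} [L.Structure A]
    [L.Structure F] (hA : K.Mem A) (hAκ : #A = κ) (hF : K.Mem F) (hFκ : #F = Order.succ κ) :
    ∃ D : Ordinal.{u} → L.Substructure F, K.IsUniversalChain κ (Order.succ κ).ord D ∧
      Nonempty (A ≃[L] D 0) ∧ ⨆ i < (Order.succ κ).ord, D i = ⊤ := by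
  obtain ⟨M, _, D, hM, hD, ⟨e₀⟩⟩ := hK.exists_isUniversalChain hcat hκ hA hAκ
  have hl : Order.IsSuccLimit (Order.succ κ).ord := isSuccLimit_ord (hκ.trans (Order.le_succ κ))
  obtain ⟨e⟩ := hcat.categorical.2 (⨆ i < (Order.succ κ).ord, D i : L.Substructure M) F
    (hK.union_mem _ _ D hl hD.cont) (hD.card_iSup hκ hcat hM) hF hFκ
  set U : L.Substructure M := ⨆ i < (Order.succ κ).ord, D i with hU
  have hr : ∀ i < (Order.succ κ).ord,
      D i = ((D i).comap U.subtype.toHom).map U.subtype.toHom := fun i hi => by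
    refine (map_comap_of_le_range U.subtype ?_).symm
    rw [Substructure.range_subtype]
    exact le_iSup₂ (f := fun i (_ : i < (Order.succ κ).ord) => D i) i hi
  have hD' := (isUniversalChain_map_iff hK.toIsAbstractClass U.subtype).1 (hD.congr hl hr)
  refine ⟨fun i => ((D i).comap U.subtype.toHom).map e.toEmbedding.toHom,
    (isUniversalChain_map_iff hK.toIsAbstractClass e.toEmbedding).2 hD', ?_, ?_⟩
  · have e₁ := U.subtype.substructureEquivMap ((D 0).comap U.subtype.toHom)
    rw [← hr 0 hl.bot_lt] at e₁
    exact ⟨(e.toEmbedding.substructureEquivMap _).comp (e₁.symm.comp e₀)⟩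
  · rw [eq_top_iff]
    intro x _
    obtain ⟨i, hi, hx⟩ := (hD.cont.mem_iSup_iff hl).1 (e.symm x).2
    refine le_iSup₂ (f := fun i (_ : i < (Order.succ κ).ord) =>
      ((D i).comap U.subtype.toHom).map e.toEmbedding.toHom) i hi ?_
    exact ⟨e.symm x, hx, e.apply_symm_apply x⟩

/-- The witnessing chain is `D i`, `D (j + 1)`, `D (j + 2)`, …: since `D i ≼ D j`, amalgamation
makes `D (j + 1)` universal over `D i` too, and changing the first term does not affect limits. -/
theorem IsUniversalChain.isLimitOver (hK : K.IsAbstractClass) (hcat : K.IsStronglyCategorical κ)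
    {θ δ i j : Ordinal.{u}} (hD : K.IsUniversalChain κ θ D)
    (hδ : Order.IsSuccLimit δ) (hij : i ≤ j) (hjδ : j + δ < θ) :
    K.IsLimitOver κ δ (D (j + δ)) (D i) := by
  classical
  have hjθ : ∀ k < δ, j + k < θ := fun k hk => (add_lt_add_right hk j).trans hjδ
  have hiθ : i < θ := hij.trans_lt (by simpa using hjθ 0 hδ.bot_lt)
  let E : Ordinal.{u} → L.Substructure M := fun k => if k = 0 then D i else D (j + k)
  have hE0 : E 0 = D i := if_pos rfl
  have hE : ∀ k, k ≠ 0 → E k = D (j + k) := fun k hk => if_neg hk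
  have hEle : ∀ k < δ, E k ≤ D (j + k) := fun k hk => by
    rcases eq_or_ne k 0 with rfl | h
    · rw [hE0]
      exact (hD.cont.strong i _ (hij.trans (le_add_of_nonneg_right bot_le)) (hjθ _ hk)).1
    · rw [hE k h]
  have hsup : ∀ k ≤ δ, Order.IsSuccLimit k → D (j + k) = ⨆ l < k, E l := by
    intro k hk hkl
    have hjk : j + k < θ := (add_le_add_right hk j).trans_lt hjδ
    rw [hD.cont.cont (j + k) hjk (Ordinal.isSuccLimit_add j hkl)]
    apply le_antisymm
    · refine iSup₂_le fun l hl => ?_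
      -- The bound is taken at `m + 1` rather than `m` to avoid index `0`, where `E` is `D i` and
      -- not `D j`.
      obtain ⟨m, hm, hlm⟩ := (Ordinal.lt_add_iff hkl.ne_bot).1 hl
      have hm' := hkl.add_one_lt hm
      have h1 : l ≤ j + (m + 1) := hlm.trans (add_le_add_right (le_add_of_nonneg_right bot_le) j)
      refine le_trans ?_ (le_iSup₂ (f := fun l (_ : l < k) => E l) (m + 1) hm')
      rw [hE (m + 1) (Order.bot_lt_succ m).ne']
      exact (hD.cont.strong l _ h1 (hjθ _ (hm'.trans_le hk))).1
    · refine iSup₂_le fun l hl => (hEle l (hl.trans_le hk)).trans ?_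
      exact le_iSup₂ (f := fun l (_ : l < j + k) => D l) (j + l) (add_lt_add_right hl j)
  have hEcard : ∀ k < δ, #(E k) = κ := fun k hk => by
    rcases eq_or_ne k 0 with rfl | h
    · rw [hE0]
      exact hD.card i hiθ
    · rw [hE k h]
      exact hD.card _ (hjθ k hk)
  have hEmem : ∀ k < δ, K.Mem (E k) := fun k hk => by
    rcases eq_or_ne k 0 with rfl | h
    · rw [hE0]
      exact hD.cont.mem i hiθ
    · rw [hE k h]
      exact hD.cont.mem _ (hjθ k hk)
  refine isLimitOver_iff.2 ⟨hD.cont.strong i _ (hij.trans (le_add_of_nonneg_right bot_le)) hjδ,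
    E, ⟨⟨hEmem, fun k l hkl hl => ?_, fun k hk hkl => ?_⟩, fun k hk => ?_, hEcard⟩, hE0,
    hsup δ le_rfl hδ⟩
  · rcases eq_or_ne k 0 with rfl | h
    · rcases eq_or_ne l 0 with rfl | h'
      · exact hK.strongLE_refl (hEmem 0 hl)
      · rw [hE0, hE l h']
        exact hD.cont.strong i _ (hij.trans (le_add_of_nonneg_right bot_le)) (hjθ l hl)
    · rw [hE k h, hE l (fun h0 => h (le_bot_iff.1 (hkl.trans h0.le)))]
      exact hD.cont.strong _ _ (add_le_add_right hkl j) (hjθ l hl)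
  · rw [hE k hkl.ne_bot, hsup k hk.le hkl]
  · have hu := hD.universal (j + k) (hjθ k hk)
    rw [hE (k + 1) (Order.bot_lt_succ k).ne', ← add_assoc]
    rcases eq_or_ne k 0 with rfl | h
    · rw [hE0]
      exact hu.of_strongLE_left hK hcat
        (hD.cont.strong i _ (hij.trans (le_add_of_nonneg_right bot_le)) (hjθ _ hk))
        (hD.cont.mem i hiθ) (hD.card i hiθ) (hD.card _ (hjθ _ hk))
    · rw [hE k h]
      exact hu

theorem IsUniversalChain.isLimitClosedFamily (hK : K.IsAbstractClass)
    (hcat : K.IsStronglyCategorical κ) (hκ : ℵ₀ ≤ κ)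
    (hD : K.IsUniversalChain κ (Order.succ κ).ord D)
    (htop : ⨆ i < (Order.succ κ).ord, D i = ⊤) {δ : Ordinal.{u}} (hδ : Order.IsSuccLimit δ)
    (hδκ : δ < (Order.succ κ).ord) :
    K.IsLimitClosedFamily κ δ {B | ∃ i < (Order.succ κ).ord, B = D i} := by
  have hκ' := hκ.trans (Order.le_succ κ)
  have hl : Order.IsSuccLimit (Order.succ κ).ord := isSuccLimit_ord hκ'
  refine ⟨⟨D 0, 0, hl.bot_lt, rfl⟩, ?_, ?_⟩
  · rintro _ ⟨i, hi, rfl⟩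
    exact ⟨hD.cont.mem i hi, hD.card i hi⟩
  · rintro _ ⟨i, hi, rfl⟩ C hC
    obtain ⟨j, hj, hCj⟩ := hD.cont.exists_subset hκ hC (fun x _ => by
      rw [htop]
      trivial)
    have hm : max i j < (Order.succ κ).ord := max_lt hi hj
    -- An infinite cardinal's initial ordinal is closed under addition.
    have hlt : max i j + δ < (Order.succ κ).ord := Ordinal.isPrincipal_add_ord hκ' hm hδκ
    have hle : max i j ≤ max i j + δ := le_add_of_nonneg_right bot_le
    exact ⟨_, ⟨_, hlt, rfl⟩, Set.union_subset
      (hD.cont.strong i _ ((le_max_left i j).trans hle) hlt).1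
      (hCj.trans (hD.cont.strong j _ ((le_max_right i j).trans hle) hlt).1),
      hD.isLimitOver hK hcat hδ (le_max_left i j) hlt⟩

end LongChain

/-! ### Limit-closed families and infinitary equivalence -/

section Main

variable {A F : Type u} [L.Structure A] [L.Structure F] {κ : Cardinal.{u}} {δ : Ordinal.{u}}

/-- Limit-closed families transfer along `≡_{∞,κ⁺}`. -/
theorem IsLimitClosedFamily.exists_of_infEquiv (hK : K.IsAbstractClass)
    (hδ : Order.IsSuccLimit δ) {S : Set (L.Substructure F)}
    (hS : K.IsLimitClosedFamily κ δ S) (h : InfEquiv L (Order.succ κ) A F) :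
    ∃ S' : Set (L.Substructure A), K.IsLimitClosedFamily κ δ S' := by
  obtain ⟨hne, hmem, hclosed⟩ := hS
  have hext : ∀ {α : Type u} {v : α → F} {w : α → A}, TupleEquiv L (Order.succ κ) v w →
      ∀ {B' : L.Substructure F}, Set.range v = B' → ∃ e : B' ↪[L] A,
        (∀ (x : B') (a : α), (x : F) = v a → e x = w a) ∧ (e.toHom.range : Set A) = Set.range w := by
    intro α v w hvw B' hB'
    obtain ⟨e, he⟩ := hvw.exists_embedding hB'
    refine ⟨e, he, Set.Subset.antisymm ?_ ?_⟩
    · rintro _ ⟨x, rfl⟩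
      obtain ⟨a, ha⟩ := hB'.ge x.2
      exact ⟨a, (he x a ha.symm).symm⟩
    · rintro _ ⟨a, rfl⟩
      exact ⟨⟨v a, hB'.le ⟨a, rfl⟩⟩, he _ a rfl⟩
  refine ⟨{B | ∃ (α : Type u) (v : α → F) (w : α → A), TupleEquiv L (Order.succ κ) v w ∧
    (∃ B' ∈ S, Set.range v = B') ∧ Set.range w = B}, ?_, ?_, ?_⟩
  · obtain ⟨B', hB'⟩ := hne
    have h0 : TupleEquiv L (Order.succ κ) (PEmpty.elim : PEmpty.{u + 1} → F)
      (PEmpty.elim : PEmpty.{u + 1} → A) := fun φ => (h φ).symm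
    obtain ⟨y, hy⟩ := h0.exists_sumElim (Order.lt_succ_iff.2 (hmem B' hB').2.le)
      (Subtype.val : B' → F)
    have hr : Set.range (Sum.elim (PEmpty.elim : PEmpty.{u + 1} → F) (Subtype.val : B' → F))
        = B' := by
      rw [Set.Sum.elim_range, Set.range_eq_empty, Set.empty_union]
      exact Subtype.range_coe
    obtain ⟨e, -, he⟩ := hext hy hr
    exact ⟨e.toHom.range, _, _, _, hy, ⟨B', hB', hr⟩, he.symm⟩
  · rintro B ⟨α, v, w, hvw, ⟨B', hB', hv⟩, hw⟩
    obtain ⟨e, -, he⟩ := hext hvw hv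
    have hBe : e.toHom.range = B := SetLike.coe_injective (he.trans hw)
    obtain ⟨h1, h2⟩ := hmem B' hB'
    rw [← hBe]
    exact ⟨hK.mem_iso _ _ e.equivRange h1, (mk_congr e.equivRange.toEquiv).symm.trans h2⟩
  · rintro B ⟨α, v, w, hvw, ⟨B', hB', hv⟩, hw⟩ C hC
    -- `C` is first matched by a tuple in `F`, the family there absorbs it into a limit `B₁`, and an
    -- enumeration of `B₁` is matched back in `A`. The tuple keeps `v` and `c`, so the new member
    -- contains both `B` and `C`.
    obtain ⟨c, hc⟩ := hvw.symm.exists_sumElim (Order.lt_succ_iff.2 hC) (Subtype.val : C → A)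
    obtain ⟨B₁, hB₁, hsub, hlim⟩ := hclosed B' hB' (Set.range c) (mk_range_le.trans hC)
    obtain ⟨t, ht⟩ := hc.symm.exists_sumElim (Order.lt_succ_iff.2 (hmem B₁ hB₁).2.le)
      (Subtype.val : B₁ → F)
    have hr : Set.range (Sum.elim (Sum.elim v c) (Subtype.val : B₁ → F)) = B₁ := by
      rw [Set.Sum.elim_range, Set.Sum.elim_range, Subtype.range_coe]
      exact Set.union_eq_right.2 (hv ▸ hsub)
    obtain ⟨e, he, her⟩ := hext ht hr
    refine ⟨e.toHom.range, ⟨_, _, _, ht, ⟨B₁, hB₁, hr⟩, her.symm⟩, ?_, ?_⟩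
    · rw [her, Set.Sum.elim_range, Set.Sum.elim_range, Subtype.range_coe, hw]
      exact Set.subset_union_left
    -- The embedding `e` is defined only on `B₁`, so the limit property is restated inside `B₁`
    -- before being mapped to `A`.
    · have h1 : (B'.comap B₁.subtype.toHom).map B₁.subtype.toHom = B' :=
        map_comap_of_le_range _ (hlim.1.1.trans_eq B₁.range_subtype.symm)
      have h2 : (⊤ : L.Substructure B₁).map B₁.subtype.toHom = B₁ := by
        rw [← Hom.range_eq_map, Substructure.range_subtype]
      have h3 : K.IsLimitOver κ δ (⊤ : L.Substructure B₁) (B'.comap B₁.subtype.toHom) := by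
        rw [← isLimitOver_map_iff hK B₁.subtype hδ, h1, h2]
        exact hlim
      have h4 := (isLimitOver_map_iff hK e hδ).2 h3
      have h5 : (B'.comap B₁.subtype.toHom).map e.toHom = B := by
        ext x
        rw [← SetLike.mem_coe, ← SetLike.mem_coe, ← hw]
        constructor
        · rintro ⟨y, hy, rfl⟩
          obtain ⟨a, ha⟩ := hv.ge hy
          exact ⟨a, (he y (Sum.inl (Sum.inl a)) ha.symm).symm⟩
        · rintro ⟨a, rfl⟩
          have hva : v a ∈ B' := hv.le ⟨a, rfl⟩
          exact ⟨⟨v a, hlim.1.1 hva⟩, hva, he _ (Sum.inl (Sum.inl a)) rfl⟩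
      rwa [h5, ← Hom.range_eq_map] at h4

/-- Structures with limit-closed families of the same length that share a structure up to
isomorphism are `≡_{∞,κ⁺}`. -/
theorem IsLimitClosedFamily.infEquiv (hK : K.IsAbstractClass) (hδ : Order.IsSuccLimit δ)
    {S : Set (L.Substructure A)} {T : Set (L.Substructure F)}
    (hS : K.IsLimitClosedFamily κ δ S) (hT : K.IsLimitClosedFamily κ δ T)
    {B : L.Substructure A} {B' : L.Substructure F} (hB : B ∈ S) (hB' : B' ∈ T) (e : B ≃[L] B') :
    InfEquiv L (Order.succ κ) A F := by
  refine infEquiv_of_backAndForth (S := {p | p.dom ∈ S ∧ p.cod ∈ T}) ⟨⟨B, B', e⟩, hB, hB'⟩ ?_ ?_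
  · rintro p ⟨hd, hc⟩ C hC
    obtain ⟨B₁, hB₁, hsub, hlim⟩ := hS.2.2 _ hd C (Order.lt_succ_iff.1 hC)
    -- Nothing has to be covered on this side; `∅` just produces a limit of the same length, and
    -- uniqueness of limits extends `p`.
    obtain ⟨B₂, hB₂, -, hlim'⟩ := hT.2.2 _ hc ∅ (by simp)
    obtain ⟨q, hpq, rfl, rfl⟩ := hlim.exists_partialEquiv hK hδ hlim' p rfl rfl
    exact ⟨q, ⟨hB₁, hB₂⟩, hpq, Set.subset_union_right.trans hsub⟩
  · rintro p ⟨hd, hc⟩ C hC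
    obtain ⟨B₁, hB₁, -, hlim⟩ := hS.2.2 _ hd ∅ (by simp)
    obtain ⟨B₂, hB₂, hsub, hlim'⟩ := hT.2.2 _ hc C (Order.lt_succ_iff.1 hC)
    obtain ⟨q, hpq, rfl, rfl⟩ := hlim.exists_partialEquiv hK hδ hlim' p rfl rfl
    exact ⟨q, ⟨hB₁, hB₂⟩, hpq, Set.subset_union_right.trans hsub⟩

theorem IsWeakAEC.exists_mem_card_eq {μ : Cardinal.{u}} (hK : K.IsWeakAEC μ) (hκ : ℵ₀ ≤ κ)
    (hμκ : μ ≤ κ) (hF : K.Mem F) (hFκ : κ ≤ #F) : ∃ N : L.Substructure F, K.Mem N ∧ #N = κ := by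
  obtain ⟨X, hX⟩ := le_mk_iff_exists_set.1 hFκ
  obtain ⟨N, hXN, hN, hcard⟩ := hK.isLSNumber.2 F hF X
  refine ⟨N, (hK.mem_of_strong F N hN).2, le_antisymm ?_ ?_⟩
  · refine hcard.trans ?_
    rw [hX]
    exact add_le_of_le hκ le_rfl hμκ
  · rw [← hX]
    exact mk_le_mk_of_subset hXN

end Main

end StructureClass
end KuekerAEC

theorem theorem3p7 {L : FirstOrder.Language.{u, u}} (K : KuekerAEC.StructureClass L) (μ κ : Cardinal.{u})
    (hK : K.IsWeakAEC μ) (hμκ : μ + ℵ₀ ≤ κ) (hcat : K.IsStronglyCategorical κ)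
    (A : Type u) [L.Structure A] :
    List.TFAE [
      K.IsInfFree κ A,
      ∀ δ : Ordinal.{u}, Order.IsSuccLimit δ → δ < (Order.succ κ).ord →
        ∃ S : Set (L.Substructure A), K.IsLimitClosedFamily κ δ S,
      K.IsStronglyFree κ A] := by
  have hκ : ℵ₀ ≤ κ := le_add_self.trans hμκ
  have hμ : μ ≤ κ := le_self_add.trans hμκ
  have hK' := hK.toIsAbstractClass
  tfae_have 1 → 2 := by
    rintro ⟨F, _, hF, hFκ, hAF⟩ δ hδ hδκ
    obtain ⟨N, hN, hNκ⟩ := hK.exists_mem_card_eq hκ hμ hF ((Order.le_succ κ).trans hFκ.ge)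
    obtain ⟨D, hD, -, htop⟩ := hK.exists_isUniversalChain_of_card hcat hκ hN hNκ hF hFκ
    exact (hD.isLimitClosedFamily hK' hcat hκ htop hδ hδκ).exists_of_infEquiv hK' hδ hAF
  tfae_have 2 → 3 := by
    intro h
    have hω : Ordinal.omega0 < (Order.succ κ).ord := by
      rw [← ord_aleph0, ord_lt_ord]
      exact hκ.trans_lt (Order.lt_succ κ)
    exact ⟨_, Ordinal.isSuccLimit_omega0, hω, h _ Ordinal.isSuccLimit_omega0 hω⟩
  tfae_have 3 → 1 := by
    rintro ⟨δ, hδ, hδκ, S, hS⟩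
    obtain ⟨F, _, hF, hFκ⟩ := hcat.categorical.1
    obtain ⟨B, hB⟩ := hS.1
    -- Starting the chain in `F` at a copy of `B` gives the two families a common member up to
    -- isomorphism.
    obtain ⟨D, hD, ⟨e⟩, htop⟩ := hK.exists_isUniversalChain_of_card hcat hκ (hS.2.1 B hB).1
      (hS.2.1 B hB).2 hF hFκ
    have hl := isSuccLimit_ord (hκ.trans (Order.le_succ κ))
    exact ⟨F, _, hF, hFκ, hS.infEquiv hK' hδ
      (hD.isLimitClosedFamily hK' hcat hκ htop hδ hδκ) hB ⟨0, hl.bot_lt, rfl⟩ e⟩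
  tfae_finish
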